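/- Let $M$ be a smooth $7$-manifold with a spin structure: a twofold covering $\widetilde{\mathcal P}\to\mathcal P$ of the bundle of oriented frames of $M$ (a principal bundle for the group $\mathrm{GL}^+$ of $7\times 7$ matrices of positive determinant), equivariant with respect to $\rho:\mathrm{Spin}(7)\to\mathrm{SO}(7)$ for a free continuous right action of $\mathrm{Spin}(7)$ on $\widetilde{\mathcal P}$. Let $\Delta$ be a real spin module, that is, an irreducible real module over the Clifford algebra $\mathrm{Cl}_7$ (with $x\cdot x=-|x|^2$) with a scalar product for which Clifford multiplication by vectors is skew-symmetric. Let $\Sigma=\widetilde{\mathcal P}\times_{\mathrm{Spin}(7)}\Delta$ be the universal spinor bundle. A point $s=[\sigma,v]$ of $\Sigma$ over $x\in M$ is a pair $(g,\psi)$, where $g$ is the metric on $T_xM$ for which the frame $p:\mathbb R^7\to T_xM$ covered by $\sigma$ is orthonormal and $\psi$ is a spinor for $g$ with $|\psi|_g=|v|$. Let $\Sigma_1\subset\Sigma$ be the set of pairs with $|\psi|_g=1$. The Bourguignon–Gauduchon horizontal distribution $H$ on $\Sigma$ is tangent to the fibres of $\Sigma\to M$ and is defined as follows: the horizontal space at a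 frame $p$ at $x$ is $\{p\circ S\mid S\in\mathrm{End}(\mathbb R^7)\text{ symmetric}\}\subset \mathrm{Hom}(\mathbb R^7,T_xM)$; it lifts to a horizontal space $\mathrm{Hor}_\sigma$ at each $\sigma\in\widetilde{\mathcal P}$, and $H_{[\sigma,v]}$ is the image of $\mathrm{Hor}_\sigma\times\{0\}$ under the differential of $\widetilde{\mathcal P}\times\Delta\to\Sigma$. It is tangent to $\Sigma_1$. For $(g,\psi)\in\Sigma_1$ over $x$ let $\Omega(g,\psi)\in\Lambda^3T_x^*M$ be the three-form $$\Omega(g,\psi)_{abc}=\langle e_a\cdot e_b\cdot e_c\cdot\psi,\psi\rangle_g ,$$ where $(e_1,\dots,e_7)$ is an oriented $g$-orthonormal frame; $g$ is called the metric of $\omega=\Omega(g,\psi)$. Let $\Lambda^3_+$ be the set of three-forms on tangent spaces $T_xM$ that are equivalent to some $\Omega(g,\psi)$, $(g,\psi)\in\Sigma_1$ over $x$, under an automorphism of $T_xM$ of positive determinant. For $\omega\in\Lambda^3_+$ over $x$ and $h\in S^2T^*_xM$ put $$i_\omega(h)_{abc}=h_{[a|i|}\,\omega^{i}{}_{bc]},\qquad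 \Lambda^3_{28}(\omega)=\{i_\omega(h)\mid h\in S^2T_x^*M\},$$ where indices are raised with the metric of $\omega$ and the brackets denote skew-symmetrisation in $a,b,c$ (with the factor $1/3!$). Then, for every $x\in M$: 1. $\Omega$ maps the fibre of $\Sigma_1$ over $x$ onto the fibre of $\Lambda^3_+$ over $x$, and the horizontal distribution corresponds to $\omega\mapsto\Lambda^3_{28}(\omega)$: for every $s\in\Sigma_1$ over $x$ one has $d\Omega_s(H_s)=\Lambda^3_{28}(\Omega(s))$. Moreover $h\mapsto i_{\Omega(s)}(h)$ is injective on $S^2T^*_xM$. 2. The distribution $\omega\mapsto\Lambda^3_{28}(\omega)$ on the fibre of $\Lambda^3_+$ over $x$ is not integrable, i.e. it is not true that through every point there passes an integral manifold. 3. If $s_t=(g_t,\psi_t)$, $t\in J$ with $J\subset\mathbb R$ open, is a horizontal curve in the fibre of $\Sigma_1$ over $x$ and $\omega_t=\Omega(g_t,\psi_t)$, then $g_t$ and $\omega_t$ are differentiable and $$\dot\omega_t=\tfrac32\, i_{\omega_t}(\dot g_t)\qquad (t\in J).$$ -/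

import Mathlib

open scoped Manifold ContDiff

namespace UniversalSpinor

noncomputable section

/-! ### The Clifford algebra of Euclidean 7-space, the spin group and spin modules -/

/-- The Euclidean space `ℝ⁷`. -/
abbrev E7 : Type := EuclideanSpace ℝ (Fin 7)

/-- The quadratic form `x ↦ -|x|²`, so that `x · x = -|x|²` in the Clifford algebra. -/
def cliffordForm : QuadraticForm ℝ E7 :=
  -(LinearMap.BilinMap.toQuadraticMap (innerₗ E7))

/-- The real Clifford algebra `Cl₇`. -/
abbrev Cl7 : Type := CliffordAlgebra cliffordForm

/-- The group `Spin(7) ⊂ Cl₇` (even products of unit vectors). -/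
abbrev Spin7 : Submonoid Cl7 := spinGroup cliffordForm

/-- The inclusion `ℝ⁷ ⊂ Cl₇`. -/
abbrev vec : E7 →ₗ[ℝ] Cl7 := CliffordAlgebra.ι cliffordForm

/-- `Cl₇` carries the topology of a finite-dimensional real vector space. -/
instance : TopologicalSpace Cl7 := moduleTopology ℝ Cl7

/-- A real spin module: an irreducible real module over `Cl₇`, with a scalar product for which
Clifford multiplication by vectors is skew-symmetric. -/
class IsSpinModule (Δ : Type*) [NormedAddCommGroup Δ] [InnerProductSpace ℝ Δ] [Module Cl7 Δ] :
    Prop where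
  isScalarTower : IsScalarTower ℝ Cl7 Δ
  isSimple : IsSimpleModule Cl7 Δ
  inner_vec_smul : ∀ (x : E7) (v w : Δ), inner ℝ (vec x • v) w = - inner ℝ v (vec x • w)

theorem cliffordForm_apply (x : E7) : cliffordForm x = - inner ℝ x x := by
  simp [cliffordForm]

theorem vec_mul_self (x : E7) : vec x * vec x = algebraMap ℝ Cl7 (- inner ℝ x x) := by
  rw [CliffordAlgebra.ι_sq_scalar, cliffordForm_apply]

theorem algebraMap_cl_injective : Function.Injective (algebraMap ℝ Cl7) := by
  have : Nontrivial Cl7 := (CliffordAlgebra.equivExterior cliffordForm).toEquiv.nontrivial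
  exact (algebraMap ℝ Cl7).injective

theorem vec_injective : Function.Injective vec := by
  rw [injective_iff_map_eq_zero]
  intro x hx
  have h := vec_mul_self x
  rw [hx, mul_zero, ← map_zero (algebraMap ℝ Cl7)] at h
  have h2 := algebraMap_cl_injective h
  exact inner_self_eq_zero.mp (neg_eq_zero.mp h2.symm)

theorem conj_mem_range (u : Spin7) (x : E7) :
    ∃ y : E7, vec y = (u : Cl7) * vec x * star (u : Cl7) := by
  have h := spinGroup.conjAct_smul_ι_mem_range_ι (x := spinGroup.toUnits u) (u.2) x
  rw [ConjAct.units_smul_def] at h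
  obtain ⟨y, hy⟩ := h
  exact ⟨y, hy⟩

/-- The linear map `ρ(u)` of `ℝ⁷` with `ρ(u) x = u x u⁻¹` in `Cl₇`, for `u ∈ Spin(7)`
(recall that `u⁻¹ = star u`); see `vec_rho`. -/
def rhoLin (u : Spin7) : E7 →ₗ[ℝ] E7 where
  toFun x := (conj_mem_range u x).choose
  map_add' x y := vec_injective (by
    rw [(conj_mem_range u (x + y)).choose_spec, map_add, map_add,
      (conj_mem_range u x).choose_spec, (conj_mem_range u y).choose_spec]
    noncomm_ring)
  map_smul' r x := vec_injective (by
    rw [(conj_mem_range u (r • x)).choose_spec, map_smul, RingHom.id_apply, map_smul,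
      (conj_mem_range u x).choose_spec]
    simp)

theorem vec_rhoLin (u : Spin7) (x : E7) :
    vec (rhoLin u x) = (u : Cl7) * vec x * star (u : Cl7) :=
  (conj_mem_range u x).choose_spec

theorem rhoLin_mul (u w : Spin7) (x : E7) : rhoLin u (rhoLin w x) = rhoLin (u * w) x :=
  vec_injective (by simp only [vec_rhoLin, Submonoid.coe_mul, star_mul, mul_assoc])

theorem rhoLin_one (x : E7) : rhoLin 1 x = x :=
  vec_injective (by simp [vec_rhoLin])

/-- The double covering `ρ : Spin(7) → SO(7)`, with values regarded as linear automorphisms. -/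
def rho (u : Spin7) : E7 ≃ₗ[ℝ] E7 where
  __ := rhoLin u
  invFun := rhoLin u⁻¹
  left_inv x := by
    change rhoLin u⁻¹ (rhoLin u x) = x
    rw [rhoLin_mul, inv_mul_cancel, rhoLin_one]
  right_inv x := by
    change rhoLin u (rhoLin u⁻¹ x) = x
    rw [rhoLin_mul, mul_inv_cancel, rhoLin_one]

theorem vec_rho (u : Spin7) (x : E7) :
    vec (rho u x) = (u : Cl7) * vec x * star (u : Cl7) := vec_rhoLin u x

theorem vec_rho_symm (u : Spin7) (x : E7) :
    vec ((rho u).symm x) = star (u : Cl7) * vec x * (u : Cl7) := by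
  have h : vec ((rho u).symm x) = ((u⁻¹ : Spin7) : Cl7) * vec x * star ((u⁻¹ : Spin7) : Cl7) :=
    vec_rhoLin u⁻¹ x
  rw [h, ← spinGroup.star_eq_inv, spinGroup.coe_star, star_star]

theorem inner_self_rho_symm (u : Spin7) (x : E7) :
    inner ℝ ((rho u).symm x) ((rho u).symm x) = inner ℝ x x := by
  have hu : (u : Cl7) * star (u : Cl7) = 1 := spinGroup.coe_mul_star_self u
  have hu' : star (u : Cl7) * (u : Cl7) = 1 := spinGroup.coe_star_mul_self u
  have h : algebraMap ℝ Cl7 (- inner ℝ ((rho u).symm x) ((rho u).symm x))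
      = algebraMap ℝ Cl7 (- inner ℝ x x) := by
    rw [← vec_mul_self, vec_rho_symm]
    calc star (u : Cl7) * vec x * (u : Cl7) * (star (u : Cl7) * vec x * (u : Cl7))
        = star (u : Cl7) * vec x * ((u : Cl7) * star (u : Cl7)) * vec x * (u : Cl7) := by
          noncomm_ring
      _ = star (u : Cl7) * (vec x * vec x) * (u : Cl7) := by
          rw [hu]; noncomm_ring
      _ = algebraMap ℝ Cl7 (- inner ℝ x x) := by
          rw [vec_mul_self, ← Algebra.commutes, mul_assoc, hu', mul_one]
  have h2 := algebraMap_cl_injective h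
  linarith

theorem inner_rho_symm (u : Spin7) (x y : E7) :
    inner ℝ ((rho u).symm x) ((rho u).symm y) = inner ℝ x y := by
  have h := inner_self_rho_symm u (x + y)
  rw [map_add, real_inner_add_add_self, real_inner_add_add_self, inner_self_rho_symm,
    inner_self_rho_symm] at h
  linarith

theorem inner_smul_eq {Δ : Type*} [NormedAddCommGroup Δ] [InnerProductSpace ℝ Δ] [Module Cl7 Δ]
    [hΔ : IsSpinModule Δ] (a : Cl7) (v w : Δ) :
    inner ℝ (a • v) w = inner ℝ v (star a • w) := by
  have := hΔ.isScalarTower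
  induction a using CliffordAlgebra.induction generalizing v w with
  | algebraMap r =>
    rw [CliffordAlgebra.star_algebraMap, algebraMap_smul, algebraMap_smul, real_inner_smul_left,
      real_inner_smul_right]
  | ι x => rw [CliffordAlgebra.star_ι, neg_smul, inner_neg_right]; exact hΔ.inner_vec_smul x v w
  | mul a b ha hb => rw [star_mul, mul_smul, mul_smul, ha, hb]
  | add a b ha hb => rw [star_add, add_smul, add_smul, inner_add_left, inner_add_right, ha, hb]

theorem inner_spin_smul {Δ : Type*} [NormedAddCommGroup Δ] [InnerProductSpace ℝ Δ] [Module Cl7 Δ]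
    [hΔ : IsSpinModule Δ] (u : Spin7) (v w : Δ) :
    inner ℝ ((u : Cl7) • v) ((u : Cl7) • w) = inner ℝ v w := by
  rw [inner_smul_eq, ← mul_smul, spinGroup.coe_star_mul_self, one_smul]

/-! ### Linear algebra on a 7-dimensional vector space -/

section Linear

variable {V : Type*} [AddCommGroup V] [Module ℝ V]

/-- The space of three-forms. -/
abbrev ThreeForm (V : Type*) [AddCommGroup V] [Module ℝ V] : Type _ := V [⋀^Fin 3]→ₗ[ℝ] ℝ

/-- The metric for which the frame `p` is orthonormal. -/
def frameMetric (p : E7 ≃ₗ[ℝ] V) : LinearMap.BilinForm ℝ V :=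
  (innerₗ E7).compl₁₂ p.symm.toLinearMap p.symm.toLinearMap

theorem frameMetric_apply (p : E7 ≃ₗ[ℝ] V) (X Y : V) :
    frameMetric p X Y = inner ℝ (p.symm X) (p.symm Y) := rfl

section Form

variable {Δ : Type*} [NormedAddCommGroup Δ] [InnerProductSpace ℝ Δ] [Module Cl7 Δ]
  [hΔ : IsSpinModule Δ]

/-- The linear functional `a ↦ ⟨a · v, v⟩` on `Cl₇`. -/
def spinorFunctional (v : Δ) : Cl7 →ₗ[ℝ] ℝ where
  toFun a := inner ℝ (a • v) v
  map_add' a b := by rw [add_smul, inner_add_left]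
  map_smul' r a := by
    have := hΔ.isScalarTower
    rw [smul_assoc, real_inner_smul_left, RingHom.id_apply, smul_eq_mul]

theorem inner_vec_self (x : E7) (v : Δ) : inner ℝ (vec x • v) v = 0 := by
  have h := hΔ.inner_vec_smul x v v
  rw [real_inner_comm (vec x • v) v] at h
  linarith

theorem inner_vec_scalar_mul (r : ℝ) (x : E7) (v : Δ) :
    inner ℝ ((algebraMap ℝ Cl7 r * vec x) • v) v = 0 := by
  have := hΔ.isScalarTower
  rw [mul_smul, algebraMap_smul, real_inner_smul_left, inner_vec_self, mul_zero]

theorem vec_sandwich (x y : E7) : vec x * vec y * vec x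
    = algebraMap ℝ Cl7 (-2 * inner ℝ x y) * vec x + algebraMap ℝ Cl7 (inner ℝ x x) * vec y := by
  have h1 : vec x * vec y = algebraMap ℝ Cl7 (-2 * inner ℝ x y) - vec y * vec x := by
    have h := vec_mul_self (x + y)
    rw [map_add, real_inner_add_add_self] at h
    have e : (vec x + vec y) * (vec x + vec y)
      = vec x * vec x + vec x * vec y + vec y * vec x + vec y * vec y := by noncomm_ring
    rw [e, vec_mul_self, vec_mul_self] at h
    have h3 : vec x * vec y + vec y * vec x
        = algebraMap ℝ Cl7 (-2 * inner ℝ x y) := by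
      have : algebraMap ℝ Cl7 (-(inner ℝ x x + 2 * inner ℝ x y + inner ℝ y y))
          = algebraMap ℝ Cl7 (-inner ℝ x x) + algebraMap ℝ Cl7 (-2 * inner ℝ x y)
            + algebraMap ℝ Cl7 (-inner ℝ y y) := by
        rw [← map_add, ← map_add]; congr 1; ring
      rw [this] at h
      have h4 : vec x * vec y + vec y * vec x
        = (algebraMap ℝ Cl7 (-inner ℝ x x) + vec x * vec y + vec y * vec x
          + algebraMap ℝ Cl7 (-inner ℝ y y)) - algebraMap ℝ Cl7 (-inner ℝ x x)
          - algebraMap ℝ Cl7 (-inner ℝ y y) := by abel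
      rw [h4, h]; abel
    rw [← h3]; abel
  rw [h1, sub_mul, mul_assoc (vec y), vec_mul_self, ← Algebra.commutes, map_neg (algebraMap ℝ Cl7) (inner ℝ x x),
    neg_mul (algebraMap ℝ Cl7 (inner ℝ x x)), sub_neg_eq_add]

/-- The three-form with components `⟨e_a · e_b · e_c · v, v⟩` in the frame `e = p(ε)`,
where `ε` is the standard basis of `ℝ⁷`:
`(X, Y, Z) ↦ ⟨p⁻¹X · p⁻¹Y · p⁻¹Z · v, v⟩`; see `frameForm_apply`. -/
def frameForm (p : E7 ≃ₗ[ℝ] V) (v : Δ) : ThreeForm V where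
  toMultilinearMap := (spinorFunctional v).compMultilinearMap
    ((MultilinearMap.mkPiAlgebraFin ℝ 3 Cl7).compLinearMap
      (fun _ => vec ∘ₗ p.symm.toLinearMap))
  map_eq_zero_of_eq' X i j hX hij := by
    have key : ∀ a b c : E7, (a = b ∨ b = c ∨ a = c) →
        inner ℝ ((vec a * (vec b * vec c)) • v) v = 0 := by
      rintro a b c (rfl | rfl | rfl)
      · rw [← mul_assoc, vec_mul_self, inner_vec_scalar_mul]
      · rw [vec_mul_self, ← Algebra.commutes, inner_vec_scalar_mul]
      · rw [← mul_assoc, vec_sandwich, add_smul, inner_add_left, inner_vec_scalar_mul,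
          inner_vec_scalar_mul, add_zero]
    have h : p.symm (X 0) = p.symm (X 1) ∨ p.symm (X 1) = p.symm (X 2) ∨
        p.symm (X 0) = p.symm (X 2) := by
      fin_cases i <;> fin_cases j <;> simp_all
    simpa [spinorFunctional, MultilinearMap.mkPiAlgebraFin, List.ofFn_succ] using key _ _ _ h

theorem frameForm_apply (p : E7 ≃ₗ[ℝ] V) (v : Δ) (X Y Z : V) :
    frameForm p v ![X, Y, Z]
      = inner ℝ (vec (p.symm X) • vec (p.symm Y) • vec (p.symm Z) • v) v := by
  rw [← mul_smul, ← mul_smul, mul_assoc]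
  simp [frameForm, spinorFunctional, MultilinearMap.mkPiAlgebraFin, List.ofFn_succ]

end Form

open Classical in
/-- Raising an index: the endomorphism `h♯` with `g(h♯ X, Y) = h(X, Y)`, for a metric `g`. -/
def raise [FiniteDimensional ℝ V] (g h : LinearMap.BilinForm ℝ V) : V →ₗ[ℝ] V :=
  if hg : g.Nondegenerate then (g.toDual hg).symm.toLinearMap ∘ₗ h else 0

/-- The three-form `i_φ(h)_{abc} = h_{[a|i|} φ^i_{bc]}`, indices being raised with `g` and the
brackets denoting skew-symmetrisation (with the factor `1/3!`). -/
def iMap [FiniteDimensional ℝ V] (g : LinearMap.BilinForm ℝ V) (φ : ThreeForm V)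
    (h : LinearMap.BilinForm ℝ V) : ThreeForm V :=
  (1 / 6 : ℝ) • MultilinearMap.alternatization
    (φ.toMultilinearMap.compLinearMap ![raise g h, LinearMap.id, LinearMap.id])

/-- Integrability of a distribution `D` on a set `Y` of three-forms: through every point of `Y`
passes an integral manifold, that is, a smooth immersed piece `f : U → Y` (with `U` open in some
`ℝᵏ`) such that for every `u ∈ U` the differential of `f` at `u` is a bijection onto `D (f u)`.
Smoothness and differentials of maps into the finite-dimensional space of three-forms are taken
componentwise. -/
def IsIntegrable (Y : Set (ThreeForm V)) (D : ThreeForm V → Set (ThreeForm V)) : Prop :=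
  ∀ φ ∈ Y, ∃ (k : ℕ) (U : Set (EuclideanSpace ℝ (Fin k)))
    (f : EuclideanSpace ℝ (Fin k) → ThreeForm V),
    IsOpen U ∧ (∃ u ∈ U, f u = φ) ∧ (∀ u ∈ U, f u ∈ Y) ∧
    (∀ X : Fin 3 → V, ContDiffOn ℝ ∞ (fun u => f u X) U) ∧
    ∀ u ∈ U, ∃ L : EuclideanSpace ℝ (Fin k) →ₗ[ℝ] ThreeForm V,
      (∀ (X : Fin 3 → V) (w : EuclideanSpace ℝ (Fin k)),
        fderiv ℝ (fun u' => f u' X) u w = L w X) ∧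
      Function.Injective L ∧ Set.range L = D (f u)

end Linear

/-! ### Oriented frames, spin structures and the universal spinor bundle -/

section Manifold

variable (M : Type*) [TopologicalSpace M] [ChartedSpace E7 M]

/-- The bundle of linear frames of `M`; a frame at `x` is a linear isomorphism `ℝ⁷ ≃ T_xM`. -/
structure FrameBundle where
  base : M
  frame : E7 ≃ₗ[ℝ] TangentSpace (𝓡 7) base

/-- The topology of the frame bundle, as a subspace of the sevenfold product of `TM` by means of
`(x, p) ↦ (p(ε₁), …, p(ε₇))`. -/
instance [IsManifold (𝓡 7) ∞ M] : TopologicalSpace (FrameBundle M) :=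
  TopologicalSpace.induced
    (fun f (i : Fin 7) =>
      (⟨f.base, f.frame (EuclideanSpace.single i 1)⟩ : TangentBundle (𝓡 7) M))
    inferInstance

/-- An orientation of `M`, given by the bundle of oriented frames: an open subset of the frame
bundle which at every point is one orbit of the group of matrices of positive determinant. -/
structure OrientedFrames [IsManifold (𝓡 7) ∞ M] where
  carrier : Set (FrameBundle M)
  isOpen_carrier : IsOpen carrier
  exists_frame : ∀ x : M, ∃ p, (⟨x, p⟩ : FrameBundle M) ∈ carrier
  mem_iff : ∀ (x : M) (p q : E7 ≃ₗ[ℝ] TangentSpace (𝓡 7) x), (⟨x, p⟩ : FrameBundle M) ∈ carrier →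
    ((⟨x, q⟩ : FrameBundle M) ∈ carrier ↔ 0 < LinearMap.det (q.trans p.symm).toLinearMap)

variable {M}

/-- A spin structure on the oriented manifold `M`: a twofold covering `P̃ → P` of the bundle of
oriented frames, with a free continuous right action of `Spin(7)` on `P̃` which preserves the
fibres over `M` and covers the right action of `SO(7)` on frames. (Restricted to the fibre over a
point this is the universal covering of a torsor under the matrices of positive determinant.) -/
structure SpinStructure [IsManifold (𝓡 7) ∞ M] (o : OrientedFrames M) where
  /-- the fibre of `P̃` at a point of `M` -/
  fib : M → Type*
  topology : TopologicalSpace (Bundle.TotalSpace Spin7 fib)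
  toFrame : ∀ {x : M}, fib x → (E7 ≃ₗ[ℝ] TangentSpace (𝓡 7) x)
  toFrame_mem : ∀ {x : M} (σ : fib x), (⟨x, toFrame σ⟩ : FrameBundle M) ∈ o.carrier
  isCoveringMap : IsCoveringMap (fun σ : Bundle.TotalSpace Spin7 fib =>
    (⟨⟨σ.proj, toFrame σ.snd⟩, toFrame_mem σ.snd⟩ : o.carrier))
  two_sheets : ∀ (x : M) (p : E7 ≃ₗ[ℝ] TangentSpace (𝓡 7) x),
    (⟨x, p⟩ : FrameBundle M) ∈ o.carrier → Nat.card {σ : fib x // toFrame σ = p} = 2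
  act : ∀ {x : M}, fib x → Spin7 → fib x
  act_one : ∀ {x : M} (σ : fib x), act σ 1 = σ
  act_mul : ∀ {x : M} (σ : fib x) (u w : Spin7), act σ (u * w) = act (act σ u) w
  act_free : ∀ {x : M} (σ : fib x) (u : Spin7), act σ u = σ → u = 1
  continuous_act : Continuous (fun q : Bundle.TotalSpace Spin7 fib × Spin7 =>
    (⟨q.1.proj, act q.1.snd q.2⟩ : Bundle.TotalSpace Spin7 fib))
  toFrame_act : ∀ {x : M} (σ : fib x) (u : Spin7), toFrame (act σ u) = (rho u).trans (toFrame σ)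

attribute [instance] SpinStructure.topology

variable [IsManifold (𝓡 7) ∞ M] {o : OrientedFrames M} (P : SpinStructure o)
  (Δ : Type*) [NormedAddCommGroup Δ] [InnerProductSpace ℝ Δ] [Module Cl7 Δ]

/-- The equivalence relation `(σ u, u⁻¹ v) ~ (σ, v)`, `u ∈ Spin(7)`, on `P̃_x × Δ`. -/
def spinSetoid (x : M) : Setoid (P.fib x × Δ) where
  r a b := ∃ u : Spin7, b = (P.act a.1 u, ((u⁻¹ : Spin7) : Cl7) • a.2)
  iseqv :=
    { refl := fun a => ⟨1, by simp [P.act_one]⟩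
      symm := by
        rintro a _ ⟨u, rfl⟩
        refine ⟨u⁻¹, ?_⟩
        ext1
        · simp [← P.act_mul, P.act_one]
        · simp [← mul_smul, -Submonoid.coe_mul, -MulMemClass.coe_mul, ← MulMemClass.coe_mul]
      trans := by
        rintro a _ _ ⟨u, rfl⟩ ⟨w, rfl⟩
        refine ⟨u * w, ?_⟩
        ext1
        · simp [P.act_mul]
        · simp [← mul_smul, -Submonoid.coe_mul, -MulMemClass.coe_mul, ← MulMemClass.coe_mul] }

/-- The fibre over `x ∈ M` of the universal spinor bundle `Σ = P̃ ×_{Spin(7)} Δ`. -/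
def Spinor (x : M) : Type _ := Quotient (spinSetoid P Δ x)

variable {P Δ} {x : M}

/-- The class `[σ, v]`. -/
def Spinor.mk (σ : P.fib x) (v : Δ) : Spinor P Δ x := Quotient.mk (spinSetoid P Δ x) (σ, v)

/-- The metric `g = Θ(s)` on `T_xM` underlying `s = [σ, v]`: the one for which the frame covered
by `σ` is orthonormal. -/
def Spinor.metric (s : Spinor P Δ x) : LinearMap.BilinForm ℝ (TangentSpace (𝓡 7) x) :=
  Quotient.lift (fun a : P.fib x × Δ => frameMetric (P.toFrame a.1)) (by
    rintro a _ ⟨u, rfl⟩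
    refine LinearMap.ext₂ fun X Y => ?_
    rw [frameMetric_apply, frameMetric_apply, P.toFrame_act]
    exact (inner_rho_symm u _ _).symm) s

theorem Spinor.metric_mk (σ : P.fib x) (v : Δ) :
    (Spinor.mk σ v).metric = frameMetric (P.toFrame σ) := rfl

variable [IsSpinModule Δ]

theorem coe_inv_spin (u : Spin7) : ((u⁻¹ : Spin7) : Cl7) = star (u : Cl7) := rfl

/-- The norm `|ψ|_g` of `s = (g, ψ) = [σ, v]`, that is `|v|`. -/
def Spinor.norm (s : Spinor P Δ x) : ℝ :=
  Quotient.lift (fun a : P.fib x × Δ => ‖a.2‖) (by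
    rintro a _ ⟨u, rfl⟩
    change ‖a.2‖ = ‖((u⁻¹ : Spin7) : Cl7) • a.2‖
    rw [@norm_eq_sqrt_real_inner Δ, @norm_eq_sqrt_real_inner Δ, inner_spin_smul]) s

theorem Spinor.norm_mk (σ : P.fib x) (v : Δ) : (Spinor.mk σ v).norm = ‖v‖ := rfl

/-- The three-form `Ω(g, ψ)_{abc} = ⟨e_a · e_b · e_c · ψ, ψ⟩_g` on `T_xM`, where `e` is an oriented
`g`-orthonormal frame: for `s = (g, ψ) = [σ, v]` one may take for `e` the frame covered by `σ`, and
then `e_a · ψ = [σ, ε_a · v]`. -/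
def Spinor.form (s : Spinor P Δ x) : ThreeForm (TangentSpace (𝓡 7) x) :=
  Quotient.lift (fun a : P.fib x × Δ => frameForm (P.toFrame a.1) a.2) (by
    rintro a _ ⟨u, rfl⟩
    refine AlternatingMap.ext fun X => ?_
    have hX : X = ![X 0, X 1, X 2] := by
      ext i; fin_cases i <;> rfl
    rw [hX, frameForm_apply, frameForm_apply, P.toFrame_act]
    change _ = inner ℝ (vec ((rho u).symm _) • vec ((rho u).symm _) • vec ((rho u).symm _) •
      ((u⁻¹ : Spin7) : Cl7) • a.2) (((u⁻¹ : Spin7) : Cl7) • a.2)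
    have hu : (u : Cl7) * star (u : Cl7) = 1 := spinGroup.coe_mul_star_self u
    have e : ∀ y : E7, ∀ w : Δ, vec ((rho u).symm y) • ((u⁻¹ : Spin7) : Cl7) • w
        = ((u⁻¹ : Spin7) : Cl7) • vec y • w := by
      intro y w
      rw [vec_rho_symm, coe_inv_spin, ← mul_smul, ← mul_smul, mul_assoc, hu, mul_one]
    rw [e, e, e, inner_spin_smul]
    rfl) s

theorem Spinor.form_mk (σ : P.fib x) (v : Δ) :
    (Spinor.mk σ v).form = frameForm (P.toFrame σ) v := rfl

variable (P Δ x) in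
/-- The fibre over `x` of the bundle `Σ₁` of pairs `(g, ψ)` with `|ψ|_g = 1`. -/
def unitSpinors : Set (Spinor P Δ x) := {s | s.norm = 1}

/-- The curve `s` in the fibre `Σ_x` has at time `t` a velocity which is horizontal for the natural
(Bourguignon–Gauduchon) distribution.

The natural connection on the fibre of `P̃` is the lift of that on `P_x`, whose horizontal space at
the frame `p` is `{p ∘ S | S symmetric}` (the vertical one being `{p ∘ A | A skew-symmetric}`), and
the horizontal space of `Σ` at `[σ, v]` is the image of `Hor_σ × {0}` under the differential of
`P̃ × Δ → Σ`. So `s` is to be represented near `t` as `[σ, v]`, where the curve of frames `p`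
covered by `σ` has velocity `p_t ∘ S` at `t`, and `v` has velocity `0`. -/
def HorizontalAt (s : ℝ → Spinor P Δ x) (t : ℝ) : Prop :=
  ∃ (σ : ℝ → P.fib x) (v : ℝ → Δ) (S : E7 →ₗ[ℝ] E7),
    (∀ᶠ τ in nhds t, s τ = Spinor.mk (σ τ) (v τ)) ∧
    ContinuousAt (fun τ => (⟨x, σ τ⟩ : Bundle.TotalSpace Spin7 P.fib)) t ∧
    S.IsSymmetric ∧
    (∀ y : E7, HasDerivAt (fun τ => (P.toFrame (σ t)).symm (P.toFrame (σ τ) y)) (S y) t) ∧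
    HasDerivAt v 0 t

/-- The image under the differential of `Ω : Σ₁ → Λ³T*M` of the horizontal space at `s ∈ Σ₁`: the
velocities at time `0` of the curves `Ω(c)`, where `c` is a curve in `Σ₁` through `s` with
horizontal velocity at time `0`. -/
def horizontalImage (s : Spinor P Δ x) : Set (ThreeForm (TangentSpace (𝓡 7) x)) :=
  {η | ∃ c : ℝ → Spinor P Δ x, (∀ τ, c τ ∈ unitSpinors P Δ x) ∧ c 0 = s ∧ HorizontalAt c 0 ∧
    ∀ X, HasDerivAt (fun τ => (c τ).form X) (η X) 0}

variable (P Δ x) in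
/-- The set `Λ³₊` of positive three-forms on `T_xM`: those which are equivalent to some `Ω(g, ψ)`
under a linear automorphism of positive determinant. -/
def positiveForms : Set (ThreeForm (TangentSpace (𝓡 7) x)) :=
  {φ | ∃ s ∈ unitSpinors P Δ x,
    ∃ A : TangentSpace (𝓡 7) x ≃ₗ[ℝ] TangentSpace (𝓡 7) x,
      0 < LinearMap.det A.toLinearMap ∧ φ = s.form.compLinearMap A.toLinearMap}

variable (P Δ) in
/-- `g` is the metric `g_φ` of the three-form `φ`. -/
def IsCompatible (g : LinearMap.BilinForm ℝ (TangentSpace (𝓡 7) x))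
    (φ : ThreeForm (TangentSpace (𝓡 7) x)) : Prop :=
  ∃ s ∈ unitSpinors P Δ x, s.metric = g ∧ s.form = φ

instance : FiniteDimensional ℝ (TangentSpace (𝓡 7) x) :=
  inferInstanceAs (FiniteDimensional ℝ E7)

variable (P Δ) in
/-- `Λ³₂₈(φ) = {i_φ(h) | h ∈ S²T*_xM}`, where indices are raised with the metric of `φ`. -/
def Lambda28 (φ : ThreeForm (TangentSpace (𝓡 7) x)) : Set (ThreeForm (TangentSpace (𝓡 7) x)) :=
  {η | ∃ g h : LinearMap.BilinForm ℝ (TangentSpace (𝓡 7) x),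
    IsCompatible P Δ g φ ∧ h.IsSymm ∧ η = iMap g φ h}

end Manifold

end

end UniversalSpinor

open UniversalSpinor

/-!
In a frame `p` of `T_xM` the form `Ω([σ, v])` is the fixed three-form
`φ(x, y, z) = ⟨x · y · z · v, v⟩` of `ℝ⁷`, so that the theorem reduces to the geometry of `φ` under
`GL(7)`.

The spinor module has dimension at most `8`: a simultaneous eigenvector of the products
`e_i e_j e_k` over the lines of a Fano plane spans with the `e_i` a submodule
(`exists_range_spinorMap_eq_top`). Hence for a unit spinor `v` every spinor is uniquely
`r v + y · v`, and `x · y · v = -⟨x, y⟩ v - (x × y) · v` defines a cross product on `ℝ⁷` whose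
three-form is `φ` (`exists_isCrossForm`). From the identity `x × (x × y) = ⟨x, y⟩ x - |x|² y` alone
follow
* the stabiliser of `φ` in `𝔤𝔩(7)` is skew-symmetric (`IsCrossProduct.skew_of_annihilates`), by
  taking traces; this gives the injectivity of `i_ω`, since `i_ω(h)` is a third of the derivative
  of `ω` in the direction `h♯`;
* `φ` determines the scalar product (`IsCrossProduct.isometry_of_map_form`), so that the metric of
  a positive form is well defined;
* the stabiliser has dimension at most `14 = 49 - 35`, so that `𝔤𝔩(7)` acts infinitesimally onto
  all three-forms (`IsCrossForm.range_formDeriv`);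
* commutators of symmetric endomorphisms need not act on `φ` like symmetric endomorphisms
  (`IsCrossForm.exists_symmetric_commutator`).

Along a horizontal curve the frame moves by `p ∘ S` with `S` symmetric and `v` is stationary, so the
metric has velocity `-2 ⟨S p⁻¹ ·, p⁻¹ ·⟩` and the three-form moves by the derivative in the direction
`-S`; this is the formula `ω' = 3/2 i_ω(g')` and one inclusion in `dΩ(H) = Λ³₂₈`. For the other
inclusion the curve `p ∘ exp (t S)` is lifted through the local homeomorphism `P̃ → P`.

If there were an integral manifold `f` through `φ`, then by the inverse function theorem
`f = A^* φ` with a smooth function `A` with values in `GL(7)`, and `dA · A⁻¹` would take its values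
in the sum of the symmetric endomorphisms and the stabiliser of `φ`, with every symmetric
endomorphism attained modulo the stabiliser. By the symmetry of the second derivative of `A` the
commutators would lie in this sum as well (`map_commutator_eq_zero`), which they do not.
-/

namespace UniversalSpinor

open scoped Manifold ContDiff Topology
open Module

/-! ### Seven-dimensional cross products -/

/-- A cross product on `ℝ⁷`: a bilinear product for which `(x, y, z) ↦ ⟨x × y, z⟩` is alternating
and `x × (x × y) = ⟨x, y⟩ x - |x|² y`. -/
structure IsCrossProduct (B : E7 →ₗ[ℝ] E7 →ₗ[ℝ] E7) : Prop where
  swap : ∀ x y, B x y = - B y x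
  inner_left : ∀ x y z, inner ℝ (B x y) z = - inner ℝ y (B x z)
  cross_cross : ∀ x y, B x (B x y) = inner ℝ x y • x - inner ℝ x x • y

namespace IsCrossProduct

variable {B : E7 →ₗ[ℝ] E7 →ₗ[ℝ] E7} (hB : IsCrossProduct B)
include hB

theorem self_eq_zero (x : E7) : B x x = 0 := by
  have h := hB.swap x x
  rwa [eq_neg_iff_add_eq_zero, ← two_smul ℝ, smul_eq_zero_iff_right two_ne_zero] at h

theorem inner_cross_left (x y : E7) : inner ℝ (B x y) x = 0 := by
  rw [hB.inner_left, hB.self_eq_zero, inner_zero_right, neg_zero]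

theorem inner_cross_right (x y : E7) : inner ℝ (B x y) y = 0 := by
  rw [hB.swap, inner_neg_left, hB.inner_cross_left, neg_zero]

theorem inner_cyclic (x y z : E7) : inner ℝ (B x y) z = inner ℝ (B y z) x := by
  rw [hB.swap x y, inner_neg_left, hB.inner_left y x z, neg_neg, real_inner_comm]

theorem cross_cross_polar (x z y : E7) :
    B x (B z y) + B z (B x y)
      = inner ℝ x y • z + inner ℝ z y • x - (2 * inner ℝ x z) • y := by
  have h := hB.cross_cross (x + z) y
  simp only [map_add, LinearMap.add_apply, hB.cross_cross x y, hB.cross_cross z y,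
    inner_add_left, inner_add_right, real_inner_comm x z] at h
  rw [← sub_eq_zero] at h ⊢
  rw [← h]
  module

theorem norm_cross_sq {x y : E7} (hxy : inner ℝ x y = 0) :
    inner ℝ (B x y) (B x y) = inner ℝ x x * inner ℝ y y := by
  rw [hB.inner_left, hB.cross_cross, hxy, zero_smul, zero_sub, inner_neg_right, neg_neg,
    real_inner_smul_right]

theorem cross_ne_zero {x y : E7} (hxy : inner ℝ x y = 0) (hx : x ≠ 0) (hy : y ≠ 0) :
    B x y ≠ 0 := by
  rw [← inner_self_ne_zero (𝕜 := ℝ), hB.norm_cross_sq hxy]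
  exact mul_ne_zero (inner_self_ne_zero.mpr hx) (inner_self_ne_zero.mpr hy)

/-- On pairwise orthogonal vectors the cross product is associative up to sign. -/
theorem cross_assoc {x y w : E7} (hxy : inner ℝ x y = 0) (hxw : inner ℝ x w = 0)
    (hyw : inner ℝ y w = 0) : B x (B y w) = - B (B x y) w := by
  have h := hB.cross_cross_polar x w y
  rw [real_inner_comm y w, hxy, hxw, hyw, mul_zero, zero_smul, zero_smul, zero_smul, hB.swap w y,
    map_neg, add_zero, sub_zero, neg_add_eq_zero] at h
  rw [h, hB.swap w]

theorem cross_cross_trace (x y : E7) :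
    LinearMap.trace ℝ E7 (B x ∘ₗ B y) = -6 * inner ℝ x y := by
  have h1 : B x ∘ₗ B y + B y ∘ₗ B x = (innerₗ E7 x).smulRight y + (innerₗ E7 y).smulRight x
      - (2 * inner ℝ x y) • LinearMap.id := by
    ext1 z
    simpa using hB.cross_cross_polar x y z
  have h2 := congrArg (LinearMap.trace ℝ E7) h1
  rw [map_add, map_sub, map_add, map_smul, LinearMap.trace_id, LinearMap.trace_comp_comm' (B x) (B y),
    LinearMap.trace_smulRight, LinearMap.trace_smulRight] at h2
  simp [real_inner_comm x y] at h2
  linarith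

end IsCrossProduct

theorem trace_adjoint_eq (a : E7 →ₗ[ℝ] E7) :
    LinearMap.trace ℝ E7 (LinearMap.adjoint a) = LinearMap.trace ℝ E7 a := by
  rw [LinearMap.trace_eq_sum_inner _ (EuclideanSpace.basisFun (Fin 7) ℝ),
    LinearMap.trace_eq_sum_inner _ (EuclideanSpace.basisFun (Fin 7) ℝ)]
  exact Finset.sum_congr rfl fun i _ => by rw [LinearMap.adjoint_inner_right, real_inner_comm]

namespace IsCrossProduct

variable {B : E7 →ₗ[ℝ] E7 →ₗ[ℝ] E7} (hB : IsCrossProduct B)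
include hB

theorem adjoint_eq_neg (x : E7) : LinearMap.adjoint (B x) = - B x := by
  symm
  rw [LinearMap.eq_adjoint_iff]
  intro y z
  rw [LinearMap.neg_apply, inner_neg_left, hB.inner_left, neg_neg]

/-- The stabiliser in `𝔤𝔩(7)` of the three-form of a cross product consists of skew-symmetric
endomorphisms. Pairing the stabiliser equation with `B y` by the trace form expresses the symmetric
part of `a` as a multiple of the identity, and then as zero. -/
theorem skew_of_annihilates {a : E7 →ₗ[ℝ] E7}
    (h : ∀ x y z, inner ℝ (B (a x) y) z + inner ℝ (B x (a y)) z + inner ℝ (B x y) (a z) = 0)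
    (x y : E7) : inner ℝ (a x) y = - inner ℝ x (a y) := by
  have h1 : ∀ x, B (a x) + B x ∘ₗ a + LinearMap.adjoint a ∘ₗ B x = 0 := by
    intro x
    ext1 y
    refine ext_inner_right ℝ fun z => ?_
    simpa [inner_add_left, LinearMap.adjoint_inner_left] using h x y z
  have h2 : ∀ x y, -6 * inner ℝ (a x) y + 2 * LinearMap.trace ℝ E7 (a ∘ₗ B y ∘ₗ B x) = 0 := by
    intro x y
    have e1 : LinearMap.trace ℝ E7 ((B x ∘ₗ a) ∘ₗ B y)
        = LinearMap.trace ℝ E7 (a ∘ₗ B y ∘ₗ B x) := by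
      rw [LinearMap.comp_assoc, LinearMap.trace_comp_comm', LinearMap.comp_assoc]
    have e2 : LinearMap.trace ℝ E7 ((LinearMap.adjoint a ∘ₗ B x) ∘ₗ B y)
        = LinearMap.trace ℝ E7 (a ∘ₗ B y ∘ₗ B x) := by
      rw [← trace_adjoint_eq, LinearMap.adjoint_comp, LinearMap.adjoint_comp,
        LinearMap.adjoint_adjoint, hB.adjoint_eq_neg, hB.adjoint_eq_neg, LinearMap.neg_comp,
        LinearMap.neg_comp, LinearMap.comp_neg, neg_neg, ← LinearMap.comp_assoc,
        LinearMap.trace_comp_comm']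
    have e := congrArg (fun f => LinearMap.trace ℝ E7 (f ∘ₗ B y)) (h1 x)
    simp only [LinearMap.add_comp, map_add, e1, e2, hB.cross_cross_trace, LinearMap.zero_comp,
      map_zero] at e
    linarith
  have h3 : ∀ x y, inner ℝ (a x) y + inner ℝ x (a y)
      = - (inner ℝ x y * LinearMap.trace ℝ E7 a) := by
    intro x y
    have e : a ∘ₗ B y ∘ₗ B x + a ∘ₗ B x ∘ₗ B y = (innerₗ E7 x).smulRight (a y)
        + (innerₗ E7 y).smulRight (a x) - (2 * inner ℝ x y) • a := by
      ext1 z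
      have := congrArg a (hB.cross_cross_polar x y z)
      rw [add_comm]
      simpa using this
    have e' := congrArg (LinearMap.trace ℝ E7) e
    rw [map_add, map_sub, map_add, map_smul, LinearMap.trace_smulRight,
      LinearMap.trace_smulRight] at e'
    simp only [innerₗ_apply_apply, smul_eq_mul] at e'
    have f1 := h2 x y
    have f2 := h2 y x
    rw [real_inner_comm x (a y)] at f2
    rw [real_inner_comm (a x) y] at e'
    linarith
  have h4 : LinearMap.trace ℝ E7 a = 0 := by
    have e : ∑ i, (inner ℝ (a (EuclideanSpace.basisFun (Fin 7) ℝ i))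
          (EuclideanSpace.basisFun (Fin 7) ℝ i)
        + inner ℝ (EuclideanSpace.basisFun (Fin 7) ℝ i) (a (EuclideanSpace.basisFun (Fin 7) ℝ i)))
        = ∑ i : Fin 7, - LinearMap.trace ℝ E7 a :=
      Finset.sum_congr rfl fun i _ => by
        rw [h3, real_inner_self_eq_norm_sq, OrthonormalBasis.norm_eq_one]; ring
    rw [Finset.sum_add_distrib, ← LinearMap.trace_eq_sum_inner] at e
    simp_rw [real_inner_comm _ (a _)] at e
    rw [← LinearMap.trace_eq_sum_inner] at e
    simp at e
    linarith
  have := h3 x y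
  rw [h4] at this
  linarith

/-! ### The metric is determined by the three-form -/

/-- Let `T = q* q` for a linear map `q` which carries the three-form of `B` to that of `B'`. The
cross product of orthogonal eigenvectors of `T` is an eigenvector for the inverse of the product of
the eigenvalues. -/
theorem eigenvector_cross {B' : E7 →ₗ[ℝ] E7 →ₗ[ℝ] E7} (hB' : IsCrossProduct B') (q : E7 ≃ₗ[ℝ] E7)
    (hq : ∀ x y z, inner ℝ (B' (q x) (q y)) (q z) = inner ℝ (B x y) z)
    {T : E7 →ₗ[ℝ] E7} (hT : ∀ x y, inner ℝ (T x) y = inner ℝ (q x) (q y))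
    {x y : E7} {l m : ℝ} (hx : x ≠ 0) (hxy : inner ℝ x y = 0)
    (hTx : T x = l • x) (hTy : T y = m • y) (hl : l ≠ 0) :
    (l * m) • T (B x y) = B x y := by
  have hTs : ∀ x y, inner ℝ (T x) y = inner ℝ x (T y) := fun x y => by
    rw [hT, ← real_inner_comm, ← hT, real_inner_comm]
  obtain ⟨u, hu⟩ : ∃ u, q u = B' (q x) (q y) := ⟨q.symm _, q.apply_symm_apply _⟩
  have hTu : T u = B x y := ext_inner_right ℝ fun z => by rw [hT, hu, hq]
  have hxx : inner ℝ x x ≠ (0 : ℝ) := inner_self_ne_zero.mpr hx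
  have h1 : B x u = -(l * m * inner ℝ x x) • y := by
    refine ext_inner_right ℝ fun z => ?_
    rw [← hq, hu, hB'.cross_cross, ← hT, ← hT, hTx, real_inner_smul_left, hxy, mul_zero, zero_smul,
      zero_sub, inner_neg_left, real_inner_smul_left, ← hT y z, hTy, real_inner_smul_left,
      real_inner_smul_left, real_inner_smul_left]
    ring
  have h2 : inner ℝ x u = (0 : ℝ) := by
    have h := hTs x u
    rw [hTu, real_inner_comm (B x y) x, hB.inner_cross_left, hTx, real_inner_smul_left] at h
    exact (mul_eq_zero.mp h).resolve_left hl
  have h3 := hB.cross_cross x u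
  rw [h1, h2, zero_smul, zero_sub, map_smul, neg_smul, neg_inj, mul_comm (l * m), mul_smul] at h3
  have h4 : (l * m) • B x y = u := smul_right_injective _ hxx h3
  rw [← map_smul, h4, hTu]

/-- Orthogonal eigenvectors have the same eigenvalue: choose a further eigenvector `w` orthogonal
to `x`, `y`, `x × y` and compare the eigenvalues of `x × (y × w) = - (x × y) × w`. -/
theorem eigenvalue_eq {B' : E7 →ₗ[ℝ] E7 →ₗ[ℝ] E7} (hB' : IsCrossProduct B') (q : E7 ≃ₗ[ℝ] E7)
    (hq : ∀ x y z, inner ℝ (B' (q x) (q y)) (q z) = inner ℝ (B x y) z)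
    {T : E7 →ₗ[ℝ] E7} (hT : ∀ x y, inner ℝ (T x) y = inner ℝ (q x) (q y))
    {x y : E7} {l m : ℝ} (hx : x ≠ 0) (hy : y ≠ 0) (hxy : inner ℝ x y = 0)
    (hTx : T x = l • x) (hTy : T y = m • y) : l = m := by
  have hTs : T.IsSymmetric := fun x y => by
    rw [hT, ← real_inner_comm, ← hT, real_inner_comm]
  have hpos : ∀ {x : E7} {l : ℝ}, x ≠ 0 → T x = l • x → 0 < l := by
    intro x l hx h
    have h1 := hT x x
    rw [h, real_inner_smul_left] at h1
    have h2 : 0 < inner ℝ (q x) (q x) :=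
      real_inner_self_pos.mpr (by simpa using hx)
    rw [← h1] at h2
    exact pos_of_mul_pos_left h2 (real_inner_self_nonneg)
  have hl := hpos hx hTx
  have hm := hpos hy hTy
  have hcross : ∀ {x y : E7} {l m : ℝ}, x ≠ 0 → inner ℝ x y = 0 → T x = l • x → T y = m • y →
      0 < l → 0 < m → T (B x y) = (l * m)⁻¹ • B x y := by
    intro x y l m hx hxy hTx hTy hl hm
    rw [eq_inv_smul_iff₀ (mul_pos hl hm).ne']
    exact hB.eigenvector_cross hB' q hq hT hx hxy hTx hTy hl.ne'
  have hTz := hcross hx hxy hTx hTy hl hm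
  have hz := hB.cross_ne_zero hxy hx hy
  obtain ⟨w, k, hw, hTw, hxw, hyw, hzw⟩ : ∃ (w : E7) (k : ℝ), w ≠ 0 ∧ T w = k • w ∧
      inner ℝ x w = 0 ∧ inner ℝ y w = 0 ∧ inner ℝ (B x y) w = 0 := by
    classical
    let N : Submodule ℝ E7 := (Submodule.span ℝ ((({x, y, B x y} : Finset E7)) : Set E7))ᗮ
    have hN : ∀ w, w ∈ N ↔ inner ℝ x w = 0 ∧ inner ℝ y w = 0 ∧ inner ℝ (B x y) w = 0 := by
      intro w
      have h : w ∈ N ↔ Submodule.span ℝ ((({x, y, B x y} : Finset E7)) : Set E7)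
          ≤ LinearMap.ker ((innerₗ E7).flip w) := Submodule.mem_orthogonal _ _
      rw [h, Submodule.span_le]
      simp [Set.insert_subset_iff, real_inner_comm w]
    have hinv : ∀ w ∈ N, T w ∈ N := by
      intro w hw
      rw [hN] at hw ⊢
      rw [← hTs, ← hTs, ← hTs, hTx, hTy, hTz, real_inner_smul_left, real_inner_smul_left,
        real_inner_smul_left, hw.1, hw.2.1, hw.2.2]
      simp
    have : Nontrivial N := by
      have h1 := Submodule.finrank_add_finrank_orthogonal
        (Submodule.span ℝ ((({x, y, B x y} : Finset E7)) : Set E7))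
      have h2 := finrank_span_finset_le_card (R := ℝ) ({x, y, B x y} : Finset E7)
      have h3 := Finset.card_le_three (a := x) (b := y) (c := B x y)
      have h4 : finrank ℝ E7 = 7 := by simp
      refine Module.nontrivial_of_finrank_pos (R := ℝ) ?_
      change 0 < finrank ℝ (Submodule.span ℝ ((({x, y, B x y} : Finset E7)) : Set E7))ᗮ
      rw [Set.finrank] at h2
      omega
    obtain ⟨w, hw⟩ := ((hTs.restrict_invariant
      hinv).hasEigenvalue_iSup_of_finiteDimensional).exists_hasEigenvector
    refine ⟨w, _, ?_, congrArg Subtype.val hw.apply_eq_smul, (hN w).mp w.2⟩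
    simpa using hw.2
  have hk := hpos hw hTw
  -- a common third factor `w` has the same eigenvalue as `x`, and by symmetry as `y`
  have key : ∀ {x y : E7} {l m : ℝ}, x ≠ 0 → y ≠ 0 → inner ℝ x y = 0 → T x = l • x → T y = m • y →
      0 < l → 0 < m → inner ℝ x w = 0 → inner ℝ y w = 0 → inner ℝ (B x y) w = 0 → l = k := by
    intro x y l m hx hy hxy hTx hTy hl hm hxw hyw hzw
    have hTz := hcross hx hxy hTx hTy hl hm
    have hz := hB.cross_ne_zero hxy hx hy
    have h1 := hcross hz hzw hTz hTw (inv_pos.mpr (mul_pos hl hm)) hk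
    have h2 := hcross hy hyw hTy hTw hm hk
    have hx2 : inner ℝ x (B y w) = 0 := by
      rw [real_inner_comm, ← hB.inner_cyclic, hzw]
    have h3 := hcross hx hx2 hTx h2 hl (inv_pos.mpr (mul_pos hm hk))
    rw [hB.cross_assoc hxy hxw hyw, map_neg, smul_neg, neg_inj, h1] at h3
    have h4 := smul_left_injective ℝ (hB.cross_ne_zero hzw hz hw) h3
    simp only [inv_inj] at h4
    field_simp at h4
    nlinarith
  rw [key hx hy hxy hTx hTy hl hm hxw hyw hzw]
  refine (key hy hx (by rw [real_inner_comm, hxy]) hTy hTx hm hl hyw hxw ?_).symm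
  rw [hB.swap, inner_neg_left, hzw, neg_zero]

/-- The three-form of a cross product determines the scalar product: a linear map carrying one such
form to another is an isometry. -/
theorem isometry_of_map_form {B' : E7 →ₗ[ℝ] E7 →ₗ[ℝ] E7} (hB' : IsCrossProduct B')
    (q : E7 ≃ₗ[ℝ] E7)
    (hq : ∀ x y z, inner ℝ (B' (q x) (q y)) (q z) = inner ℝ (B x y) z) (x y : E7) :
    inner ℝ (q x) (q y) = inner ℝ x y := by
  let T : E7 →ₗ[ℝ] E7 := LinearMap.adjoint q.toLinearMap ∘ₗ q.toLinearMap
  have hT : ∀ x y, inner ℝ (T x) y = inner ℝ (q x) (q y) := fun x y => by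
    simp [T, LinearMap.adjoint_inner_left]
  have hTs : T.IsSymmetric := fun x y => by
    rw [hT, ← real_inner_comm, ← hT, real_inner_comm]
  have h7 : finrank ℝ E7 = 7 := by simp
  let b := hTs.eigenvectorBasis h7
  have hb : ∀ i, T (b i) = (hTs.eigenvalues h7 i) • b i := hTs.apply_eigenvectorBasis h7
  have hb0 : ∀ i, b i ≠ 0 := fun i => b.orthonormal.ne_zero i
  have hone : ∀ i, hTs.eigenvalues h7 i = 1 := by
    intro i
    obtain ⟨j, hij⟩ : ∃ j, i ≠ j := ⟨i + 1, by simp⟩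
    have hij0 : inner ℝ (b i) (b j) = 0 := b.orthonormal.2 hij
    have e1 := hB.eigenvalue_eq hB' q hq hT (hb0 i) (hb0 j) hij0 (hb i) (hb j)
    set l := hTs.eigenvalues h7 i with hl
    have hl0 : l ≠ 0 := by
      intro h
      have h1 := hT (b i) (b i)
      rw [hb, ← hl, h, zero_smul, inner_zero_left] at h1
      exact hb0 i (by simpa using inner_self_eq_zero.mp h1.symm)
    have h1 := hB.eigenvector_cross hB' q hq hT (hb0 i) hij0 (hb i) (hb j) hl0
    rw [← e1] at h1
    have h2 : T (B (b i) (b j)) = (l * l)⁻¹ • B (b i) (b j) := by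
      rw [eq_inv_smul_iff₀ (mul_ne_zero hl0 hl0), h1]
    have h3 := hB.eigenvalue_eq hB' q hq hT (hb0 i) (hB.cross_ne_zero hij0 (hb0 i) (hb0 j))
      (by rw [real_inner_comm, hB.inner_cross_left]) (hb i) h2
    have h4 : l ^ 3 = 1 := by
      rw [← hl] at h3
      field_simp at h3
      rw [← h3]
    have : (l - 1) * (l ^ 2 + l + 1) = 0 := by linear_combination h4
    rcases mul_eq_zero.mp this with h | h
    · linarith
    · nlinarith [sq_nonneg (l + 1/2)]
  have hT1 : T = LinearMap.id := b.toBasis.ext fun i => by simp [hb, hone]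
  rw [← hT, hT1, LinearMap.id_apply]

end IsCrossProduct

/-! ### The infinitesimal action of endomorphisms on three-forms -/

section FormDeriv

variable {V : Type*} [AddCommGroup V] [Module ℝ V]

theorem eq_vec3 {α : Type*} (X : Fin 3 → α) : X = ![X 0, X 1, X 2] := by
  ext i; fin_cases i <;> rfl

theorem update_vec3_zero {α : Type*} (x y z w : α) :
    Function.update ![x, y, z] 0 w = ![w, y, z] := by
  ext i; fin_cases i <;> rfl

theorem update_vec3_one {α : Type*} (x y z w : α) :
    Function.update ![x, y, z] 1 w = ![x, w, z] := by
  ext i; fin_cases i <;> rfl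

theorem update_vec3_two {α : Type*} (x y z w : α) :
    Function.update ![x, y, z] 2 w = ![x, y, w] := by
  ext i; fin_cases i <;> rfl

theorem ThreeForm.ext3 {φ ψ : ThreeForm V} (h : ∀ x y z, φ ![x, y, z] = ψ ![x, y, z]) : φ = ψ :=
  AlternatingMap.ext fun X => by rw [eq_vec3 X]; exact h _ _ _

theorem alternatization_insert_apply (φ : ThreeForm V) (a : V →ₗ[ℝ] V) (x y z : V) :
    MultilinearMap.alternatization
      (φ.toMultilinearMap.compLinearMap ![a, LinearMap.id, LinearMap.id]) ![x, y, z]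
      = 2 * (φ ![a x, y, z] + φ ![x, a y, z] + φ ![x, y, a z]) := by
  have hu : (Finset.univ : Finset (Equiv.Perm (Fin 3))) =
      {1, Equiv.swap 0 1, Equiv.swap 0 2, Equiv.swap 1 2, finRotate 3, (finRotate 3)⁻¹} := by
    decide
  have e1 : φ ![a y, x, z] = - φ ![x, a y, z] := by
    rw [← φ.map_swap ![x, a y, z] (show (0 : Fin 3) ≠ 1 by decide)]
    congr 1; ext i; fin_cases i <;> rfl
  have e2 : φ ![a z, y, x] = - φ ![x, y, a z] := by
    rw [← φ.map_swap ![x, y, a z] (show (0 : Fin 3) ≠ 2 by decide)]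
    congr 1; ext i; fin_cases i <;> rfl
  have e3 : φ ![a x, z, y] = - φ ![a x, y, z] := by
    rw [← φ.map_swap ![a x, y, z] (show (1 : Fin 3) ≠ 2 by decide)]
    congr 1; ext i; fin_cases i <;> rfl
  have e4 : φ ![a y, z, x] = φ ![x, a y, z] := by
    rw [← neg_neg (φ ![x, a y, z]), ← e1,
      ← φ.map_swap ![a y, x, z] (show (1 : Fin 3) ≠ 2 by decide)]
    congr 1; ext i; fin_cases i <;> rfl
  have e5 : φ ![a z, x, y] = φ ![x, y, a z] := by
    rw [← neg_neg (φ ![x, y, a z]), ← e2,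
      ← φ.map_swap ![a z, y, x] (show (1 : Fin 3) ≠ 2 by decide)]
    congr 1; ext i; fin_cases i <;> rfl
  have hv : ∀ σ : Equiv.Perm (Fin 3), φ.toMultilinearMap.compLinearMap
      ![a, LinearMap.id, LinearMap.id] (fun i => (![x, y, z] : Fin 3 → V) (σ i))
      = φ ![a (![x, y, z] (σ 0)), ![x, y, z] (σ 1), ![x, y, z] (σ 2)] := by
    intro σ
    rw [MultilinearMap.compLinearMap_apply]
    change φ _ = _
    congr 1; ext i; fin_cases i <;> rfl
  rw [MultilinearMap.alternatization_apply, hu]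
  rw [Finset.sum_insert (by decide), Finset.sum_insert (by decide), Finset.sum_insert (by decide),
    Finset.sum_insert (by decide), Finset.sum_insert (by decide), Finset.sum_singleton]
  simp only [MultilinearMap.domDomCongr_apply, hv]
  have s1 : Equiv.Perm.sign (Equiv.swap (0 : Fin 3) 1) = -1 := by decide
  have s2 : Equiv.Perm.sign (Equiv.swap (0 : Fin 3) 2) = -1 := by decide
  have s3 : Equiv.Perm.sign (Equiv.swap (1 : Fin 3) 2) = -1 := by decide
  have s4 : Equiv.Perm.sign (finRotate 3) = 1 := by decide
  have s5 : Equiv.Perm.sign (finRotate 3)⁻¹ = 1 := by decide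
  rw [s1, s2, s3, s4, s5]
  change (1 : ℤˣ) • φ ![a x, y, z] + ((-1 : ℤˣ) • φ ![a y, x, z] + ((-1 : ℤˣ) • φ ![a z, y, x] +
    ((-1 : ℤˣ) • φ ![a x, z, y] + ((1 : ℤˣ) • φ ![a y, z, x] + (1 : ℤˣ) • φ ![a z, x, y])))) = _
  rw [e1, e2, e3, e4, e5]
  simp only [one_smul, Units.neg_smul]
  ring

/-- The infinitesimal action of an endomorphism `a` on a three-form `φ`,
`(x, y, z) ↦ φ(a x, y, z) + φ(x, a y, z) + φ(x, y, a z)`, as a linear function of `a`. -/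
noncomputable def formDeriv (φ : ThreeForm V) : (V →ₗ[ℝ] V) →ₗ[ℝ] ThreeForm V where
  toFun a := (1 / 2 : ℝ) • MultilinearMap.alternatization
    (φ.toMultilinearMap.compLinearMap ![a, LinearMap.id, LinearMap.id])
  map_add' a b := ThreeForm.ext3 fun x y z => by
    simp only [AlternatingMap.add_apply, AlternatingMap.smul_apply, alternatization_insert_apply]
    have h1 := φ.map_update_add ![x, y, z] 0 (a x) (b x)
    have h2 := φ.map_update_add ![x, y, z] 1 (a y) (b y)
    have h3 := φ.map_update_add ![x, y, z] 2 (a z) (b z)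
    simp only [update_vec3_zero, update_vec3_one, update_vec3_two] at h1 h2 h3
    rw [LinearMap.add_apply, LinearMap.add_apply, LinearMap.add_apply, h1, h2, h3, smul_eq_mul,
      smul_eq_mul, smul_eq_mul]
    ring
  map_smul' r a := ThreeForm.ext3 fun x y z => by
    simp only [AlternatingMap.smul_apply, alternatization_insert_apply, RingHom.id_apply]
    have h1 := φ.map_update_smul ![x, y, z] 0 r (a x)
    have h2 := φ.map_update_smul ![x, y, z] 1 r (a y)
    have h3 := φ.map_update_smul ![x, y, z] 2 r (a z)
    simp only [update_vec3_zero, update_vec3_one, update_vec3_two] at h1 h2 h3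
    rw [LinearMap.smul_apply, LinearMap.smul_apply, LinearMap.smul_apply, h1, h2, h3]
    simp only [smul_eq_mul]
    ring

theorem formDeriv_apply (φ : ThreeForm V) (a : V →ₗ[ℝ] V) (x y z : V) :
    formDeriv φ a ![x, y, z] = φ ![a x, y, z] + φ ![x, a y, z] + φ ![x, y, a z] := by
  change (1 / 2 : ℝ) • MultilinearMap.alternatization
    (φ.toMultilinearMap.compLinearMap ![a, LinearMap.id, LinearMap.id]) ![x, y, z] = _
  rw [alternatization_insert_apply, smul_eq_mul]
  ring

end FormDeriv

/-! ### The stabiliser and the orbit of the three-form of a cross product -/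

/-- `φ` is the three-form `(x, y, z) ↦ ⟨x × y, z⟩` of the cross product `B`. -/
structure IsCrossForm (B : E7 →ₗ[ℝ] E7 →ₗ[ℝ] E7) (φ : ThreeForm E7) : Prop extends
    IsCrossProduct B where
  apply_eq : ∀ x y z, φ ![x, y, z] = inner ℝ (B x y) z

theorem exists_ne_zero_orthogonal (x y z : E7) :
    ∃ w : E7, w ≠ 0 ∧ inner ℝ x w = 0 ∧ inner ℝ y w = 0 ∧ inner ℝ z w = 0 := by
  let f : E7 →ₗ[ℝ] (Fin 3 → ℝ) := LinearMap.pi ![innerₗ E7 x, innerₗ E7 y, innerₗ E7 z]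
  have hf : LinearMap.ker f ≠ ⊥ := LinearMap.ker_ne_bot_of_finrank_lt (by simp)
  obtain ⟨w, hw, hw0⟩ := Submodule.exists_mem_ne_zero_of_ne_bot hf
  have h := LinearMap.mem_ker.mp hw
  exact ⟨w, hw0, congrFun h 0, congrFun h 1, congrFun h 2⟩

theorem finrank_threeForm : finrank ℝ (ThreeForm E7) = 35 := by
  rw [(exteriorPower.alternatingMapLinearEquiv (R := ℝ) (M := E7) (N := ℝ) (n := 3)).finrank_eq]
  change finrank ℝ (Module.Dual ℝ _) = 35
  rw [Subspace.dual_finrank_eq, exteriorPower.finrank_eq, finrank_euclideanSpace_fin]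
  rfl

namespace IsCrossForm

variable {B : E7 →ₗ[ℝ] E7 →ₗ[ℝ] E7} {φ : ThreeForm E7} (hB : IsCrossForm B φ)
include hB

theorem skew_of_formDeriv_eq_zero {a : E7 →ₗ[ℝ] E7} (ha : formDeriv φ a = 0) (x y : E7) :
    inner ℝ (a x) y = - inner ℝ x (a y) := by
  refine hB.skew_of_annihilates (fun x y z => ?_) x y
  rw [← hB.apply_eq, ← hB.apply_eq, ← hB.apply_eq, ← formDeriv_apply, ha]
  rfl

/-- The stabiliser of the three-form acts by derivations of the cross product. -/
theorem map_cross_of_formDeriv_eq_zero {a : E7 →ₗ[ℝ] E7} (ha : formDeriv φ a = 0) (x y : E7) :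
    a (B x y) = B (a x) y + B x (a y) := by
  refine ext_inner_right ℝ fun z => ?_
  have h := formDeriv_apply φ a x y z
  rw [ha, hB.apply_eq, hB.apply_eq, hB.apply_eq] at h
  rw [hB.skew_of_formDeriv_eq_zero ha, inner_add_left]
  have h0 : (0 : ThreeForm E7) ![x, y, z] = 0 := rfl
  linarith

theorem eq_zero_of_formDeriv_eq_zero {S : E7 →ₗ[ℝ] E7} (hS : S.IsSymmetric)
    (h : formDeriv φ S = 0) : S = 0 := by
  ext1 x
  refine ext_inner_right ℝ fun y => ?_
  have h1 := hB.skew_of_formDeriv_eq_zero h x y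
  rw [← hS x y] at h1
  rw [LinearMap.zero_apply, inner_zero_left]
  linarith

theorem inner_cross_cross (l x y : E7) :
    inner ℝ (B l x) (B l y) = inner ℝ l l * inner ℝ x y - inner ℝ l x * inner ℝ l y := by
  rw [hB.inner_left, hB.cross_cross, inner_sub_right, real_inner_smul_right, real_inner_smul_right,
    real_inner_comm l x]
  ring

/-- There is an orthonormal basis `i, j, i × j, l, i × l, j × l, (i × j) × l`. -/
theorem exists_adapted_basis : ∃ u : OrthonormalBasis (Fin 7) ℝ E7, u 2 = B (u 0) (u 1) ∧
    u 4 = B (u 0) (u 3) ∧ u 5 = B (u 1) (u 3) ∧ u 6 = B (u 2) (u 3) := by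
  obtain ⟨i, j, l, hii, hjj, hll, hij, hil, hjl, hkl⟩ : ∃ i j l : E7, inner ℝ i i = (1 : ℝ) ∧
      inner ℝ j j = (1 : ℝ) ∧ inner ℝ l l = (1 : ℝ) ∧ inner ℝ i j = (0 : ℝ) ∧
      inner ℝ i l = (0 : ℝ) ∧ inner ℝ j l = (0 : ℝ) ∧ inner ℝ (B i j) l = (0 : ℝ) := by
    let i : E7 := EuclideanSpace.single 0 1
    let j : E7 := EuclideanSpace.single 1 1
    obtain ⟨w, hw, h1, h2, h3⟩ := exists_ne_zero_orthogonal i j (B i j)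
    refine ⟨i, j, ‖w‖⁻¹ • w, ?_, ?_, ?_, ?_, ?_, ?_, ?_⟩
    · simp [i]
    · simp [j]
    · rw [real_inner_smul_left, real_inner_smul_right, real_inner_self_eq_norm_sq]
      have := norm_ne_zero_iff.mpr hw
      field_simp
    · simp [i, j, EuclideanSpace.inner_single_left]
    · rw [real_inner_smul_right, h1, mul_zero]
    · rw [real_inner_smul_right, h2, mul_zero]
    · rw [real_inner_smul_right, h3, mul_zero]
  set k := B i j with hk
  have hki : inner ℝ k i = (0 : ℝ) := hB.inner_cross_left i j
  have hkj : inner ℝ k j = (0 : ℝ) := hB.inner_cross_right i j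
  have hkk : inner ℝ k k = (1 : ℝ) := by rw [hk, hB.inner_cross_cross, hii, hjj, hij]; ring
  have hji := (real_inner_comm i j).trans hij
  have hli := (real_inner_comm i l).trans hil
  have hlj := (real_inner_comm j l).trans hjl
  have hlk := (real_inner_comm k l).trans hkl
  have hik := (real_inner_comm k i).trans hki
  have hjk := (real_inner_comm k j).trans hkj
  have hik' : B i k = -j := by rw [hk, hB.cross_cross, hij, hii]; simp
  have hjk' : B j k = i := by rw [hk, hB.swap i j, map_neg, hB.cross_cross, hji, hjj]; simp
  have hcl : ∀ x y, inner ℝ l x = (0 : ℝ) → inner ℝ (B x l) (B y l) = inner ℝ x y := by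
    intro x y hx
    rw [hB.swap x, hB.swap y, inner_neg_neg, hB.inner_cross_cross, hll, hx]
    ring
  have hcr : ∀ x y, inner ℝ (B x l) y = inner ℝ (B y x) l := fun x y => by
    rw [hB.inner_cyclic, hB.inner_cyclic]
  have hcr' : ∀ x y, inner ℝ y (B x l) = inner ℝ (B y x) l := fun x y => by
    rw [real_inner_comm, hcr]
  have hon : Orthonormal ℝ ![i, j, k, l, B i l, B j l, B k l] := by
    rw [orthonormal_iff_ite]
    intro a b
    fin_cases a <;> fin_cases b <;>
    simp [-inner_self_eq_norm_sq_to_K, hcl, hcr, hcr', hii, hjj, hkk, hll, hij, hji, hik, hki, hjk, hkj, hil, hli, hjl, hlj,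
      hkl, hlk, hB.self_eq_zero, hik', hjk', ← hk, hB.swap k i, hB.swap k j, hB.swap j i,
      hB.inner_cross_left]
  refine ⟨OrthonormalBasis.mk hon ?_, ?_⟩
  · rw [hon.linearIndependent.span_eq_top_of_card_eq_finrank (by simp)]
  · simp [hk]

/-- The stabiliser of the three-form of a cross product (a copy of `𝔤₂`) has dimension at most
`14`: in an adapted basis one of its elements is determined by `6 + 5 + 3` of its entries, because
the basis is generated by three of its members. -/
theorem finrank_ker_formDeriv_le : finrank ℝ (LinearMap.ker (formDeriv φ)) ≤ 14 := by
  obtain ⟨u, h2, h4, h5, h6⟩ := hB.exists_adapted_basis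
  let p : Fin 14 → Fin 7 × Fin 7 := ![(0, 1), (0, 2), (0, 3), (0, 4), (0, 5), (0, 6),
    (1, 2), (1, 3), (1, 4), (1, 5), (1, 6), (3, 4), (3, 5), (3, 6)]
  let F : (E7 →ₗ[ℝ] E7) →ₗ[ℝ] (Fin 14 → ℝ) := LinearMap.pi fun n =>
    innerₗ E7 (u (p n).2) ∘ₗ LinearMap.applyₗ (u (p n).1)
  have hF : ∀ a n, F a n = inner ℝ (u (p n).2) (a (u (p n).1)) := fun a n => rfl
  have hinj : Function.Injective (F ∘ₗ (LinearMap.ker (formDeriv φ)).subtype) := by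
    rw [← LinearMap.ker_eq_bot, LinearMap.ker_eq_bot']
    rintro ⟨a, ha⟩ h
    rw [LinearMap.mem_ker] at ha
    have hs := hB.skew_of_formDeriv_eq_zero ha
    have hd := hB.map_cross_of_formDeriv_eq_zero ha
    have hF0 : ∀ n, inner ℝ (u (p n).2) (a (u (p n).1)) = (0 : ℝ) := fun n => congrFun h n
    have hself : ∀ x, inner ℝ x (a x) = (0 : ℝ) := fun x => by
      have := hs x x
      rw [real_inner_comm] at this
      linarith
    have hzero : ∀ x, (∀ n, inner ℝ (u n) (a x) = (0 : ℝ)) → a x = 0 := fun x hx =>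
      InnerProductSpace.ext_inner_left_basis u.toBasis fun n => by simpa using hx n
    have hswap : ∀ x y, a x = 0 → inner ℝ x (a y) = (0 : ℝ) := fun x y hx => by
      have := hs x y
      rw [hx, inner_zero_left] at this
      linarith
    have a0 : a (u 0) = 0 := hzero _ fun n => by
      fin_cases n
      · exact hself _
      · exact hF0 0
      · exact hF0 1
      · exact hF0 2
      · exact hF0 3
      · exact hF0 4
      · exact hF0 5
    have a1 : a (u 1) = 0 := hzero _ fun n => by
      fin_cases n
      · exact hswap _ _ a0
      · exact hself _
      · exact hF0 6
      · exact hF0 7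
      · exact hF0 8
      · exact hF0 9
      · exact hF0 10
    have a2 : a (u 2) = 0 := by rw [h2, hd, a0, a1]; simp
    have a3 : a (u 3) = 0 := hzero _ fun n => by
      fin_cases n
      · exact hswap _ _ a0
      · exact hswap _ _ a1
      · exact hswap _ _ a2
      · exact hself _
      · exact hF0 11
      · exact hF0 12
      · exact hF0 13
    have ha0 : a = 0 := u.toBasis.ext fun n => by
      rw [OrthonormalBasis.coe_toBasis, LinearMap.zero_apply]
      fin_cases n
      · exact a0
      · exact a1
      · exact a2
      · exact a3
      · change a (u 4) = 0
        rw [h4, hd, a0, a3]; simp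
      · change a (u 5) = 0
        rw [h5, hd, a1, a3]; simp
      · change a (u 6) = 0
        rw [h6, hd, a2, a3]; simp
    exact Subtype.ext ha0
  simpa using LinearMap.finrank_le_finrank_of_injective hinj

/-- The orbit of the three-form of a cross product under `GL(7)` is open, infinitesimally:
`49 - 14 = 35`. -/
theorem range_formDeriv : LinearMap.range (formDeriv φ) = ⊤ := by
  have : FiniteDimensional ℝ (ThreeForm E7) :=
    FiniteDimensional.of_finrank_pos (by rw [finrank_threeForm]; norm_num)
  refine Submodule.eq_top_of_finrank_eq (le_antisymm (Submodule.finrank_le _) ?_)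
  have h1 := LinearMap.finrank_range_add_finrank_ker (formDeriv φ)
  have h2 := hB.finrank_ker_formDeriv_le
  have h3 : finrank ℝ (E7 →ₗ[ℝ] E7) = 49 := by
    rw [finrank_linearMap, finrank_euclideanSpace_fin]
  rw [finrank_threeForm]
  omega

/-- The commutators of symmetric endomorphisms span the skew-symmetric ones, and these do not all
stabilise `φ`; elements of the stabiliser may be added freely. So the distribution given by the
symmetric endomorphisms is not involutive. -/
theorem exists_symmetric_commutator : ∃ S S' : E7 →ₗ[ℝ] E7, S.IsSymmetric ∧ S'.IsSymmetric ∧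
    ∀ a a' : E7 →ₗ[ℝ] E7, formDeriv φ a = formDeriv φ S → formDeriv φ a' = formDeriv φ S' →
      ∀ S'' : E7 →ₗ[ℝ] E7, S''.IsSymmetric →
        formDeriv φ (a ∘ₗ a' - a' ∘ₗ a) ≠ formDeriv φ S'' := by
  obtain ⟨u, -, -, -, -⟩ := hB.exists_adapted_basis
  have hu : ∀ m n, inner ℝ (u m) (u n) = if m = n then (1 : ℝ) else 0 :=
    orthonormal_iff_ite.mp u.orthonormal
  let i := u 0
  let j := u 1
  have hii : inner ℝ i i = (1 : ℝ) := by simp [i]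
  have hjj : inner ℝ j j = (1 : ℝ) := by simp [j]
  have hij : inner ℝ i j = (0 : ℝ) := by simp [i, j, hu]
  have hji : inner ℝ j i = (0 : ℝ) := by simp [i, j, hu]
  let S : E7 →ₗ[ℝ] E7 := (innerₗ E7 i).smulRight i
  let S' : E7 →ₗ[ℝ] E7 := (innerₗ E7 i).smulRight j + (innerₗ E7 j).smulRight i
  have hSa : ∀ x, S x = (inner ℝ i x : ℝ) • i := fun x => rfl
  have hSa' : ∀ x, S' x = (inner ℝ i x : ℝ) • j + (inner ℝ j x : ℝ) • i := fun x => rfl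
  have hS : S.IsSymmetric := fun x y => by
    rw [hSa, hSa, real_inner_smul_left, real_inner_smul_right, real_inner_comm i x]
    ring
  have hS' : S'.IsSymmetric := fun x y => by
    simp only [hSa', inner_add_left, inner_add_right, real_inner_smul_left, real_inner_smul_right,
      real_inner_comm x]
    ring
  refine ⟨S, S', hS, hS', fun a a' ha ha' S'' hS'' h => ?_⟩
  obtain ⟨ξ, rfl⟩ : ∃ ξ, a = S + ξ := ⟨a - S, by abel⟩
  obtain ⟨ξ', rfl⟩ : ∃ ξ, a' = S' + ξ := ⟨a' - S', by abel⟩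
  rw [map_add, add_eq_left] at ha ha'
  have hξ := hB.skew_of_formDeriv_eq_zero ha
  have hξ' := hB.skew_of_formDeriv_eq_zero ha'
  -- the commutator of two elements of the stabiliser lies in the stabiliser
  have hξξ : formDeriv φ (ξ ∘ₗ ξ' - ξ' ∘ₗ ξ) = 0 := ThreeForm.ext3 fun x y z => by
    have e : ∀ x y z, φ ![ξ x, y, z] + φ ![x, ξ y, z] + φ ![x, y, ξ z] = 0 := fun x y z => by
      rw [← formDeriv_apply, ha]; rfl
    have e' : ∀ x y z, φ ![ξ' x, y, z] + φ ![x, ξ' y, z] + φ ![x, y, ξ' z] = 0 := fun x y z => by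
      rw [← formDeriv_apply, ha']; rfl
    rw [map_sub, AlternatingMap.sub_apply, formDeriv_apply, formDeriv_apply]
    change _ = (0 : ℝ)
    simp only [LinearMap.comp_apply]
    linarith [e (ξ' x) y z, e x (ξ' y) z, e x y (ξ' z), e' (ξ x) y z, e' x (ξ y) z, e' x y (ξ z)]
  -- the commutator of `S`, `S'` differs from this one by a symmetric endomorphism
  let R : E7 →ₗ[ℝ] E7 := S'' - (S ∘ₗ ξ' - ξ' ∘ₗ S) - (ξ ∘ₗ S' - S' ∘ₗ ξ)
  have hR : R.IsSymmetric := fun x y => by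
    simp only [R, LinearMap.sub_apply, LinearMap.comp_apply, inner_sub_left, inner_sub_right]
    rw [hS'' x y, hS (ξ' x) y, hξ' x, hξ' (S x), hS x, hξ (S' x), hS' x, hS' (ξ x), hξ x]
    ring
  have h1 : formDeriv φ (S ∘ₗ S' - S' ∘ₗ S) = formDeriv φ R := by
    have e : (S + ξ) ∘ₗ (S' + ξ') - (S' + ξ') ∘ₗ (S + ξ)
        = (S ∘ₗ S' - S' ∘ₗ S) + (S'' - R) + (ξ ∘ₗ ξ' - ξ' ∘ₗ ξ) := by
      simp only [R, LinearMap.add_comp, LinearMap.comp_add]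
      abel
    rw [e, map_add, hξξ, add_zero, map_add, map_sub _ S'' R] at h
    rw [← sub_eq_zero] at h ⊢
    rw [← h]
    abel
  have hA : ∀ x, (S ∘ₗ S' - S' ∘ₗ S) x = (inner ℝ j x : ℝ) • i - (inner ℝ i x : ℝ) • j := by
    intro x
    simp only [LinearMap.sub_apply, LinearMap.comp_apply, hSa, hSa', inner_add_right,
      real_inner_smul_right, hii, hij, hji]
    module
  set A := S ∘ₗ S' - S' ∘ₗ S
  have h2 : formDeriv φ (A - R) = 0 := by rw [map_sub, h1, sub_self]
  have hR0 : R = 0 := by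
    ext1 x
    refine ext_inner_right ℝ fun y => ?_
    have e := hB.skew_of_formDeriv_eq_zero h2 x y
    have e2 := hR x y
    simp only [LinearMap.sub_apply, inner_sub_left, inner_sub_right, hA, real_inner_smul_left,
      real_inner_smul_right] at e
    rw [real_inner_comm i x, real_inner_comm j x] at e
    rw [LinearMap.zero_apply, inner_zero_left]
    linarith
  rw [hR0, map_zero] at h1
  obtain ⟨w, hw, hiw, hjw, hijw⟩ := exists_ne_zero_orthogonal i j (B i j)
  have h3 := hB.map_cross_of_formDeriv_eq_zero h1 i w
  have e1 : inner ℝ j (B i w) = (0 : ℝ) := by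
    rw [real_inner_comm, hB.inner_cyclic, hB.inner_cyclic, hB.swap, inner_neg_left, hijw, neg_zero]
  have e2 : inner ℝ i (B i w) = (0 : ℝ) := by
    rw [real_inner_comm, hB.inner_cross_left]
  rw [hA, hA, hA, e1, e2, hii, hji, hiw, hjw] at h3
  have hj0 : j ≠ 0 := u.orthonormal.ne_zero 1
  refine hB.cross_ne_zero hjw hj0 hw ?_
  simpa using h3.symm

end IsCrossForm

/-! ### Spinors and cross products -/

section Spin

variable {Δ : Type*} [NormedAddCommGroup Δ] [Module Cl7 Δ]

/-- The orthonormal generators of the Clifford algebra. -/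
noncomputable def gen (i : Fin 7) : Cl7 := vec (EuclideanSpace.single i 1)

theorem gen_mul_self (i : Fin 7) : gen i * gen i = -1 := by
  rw [gen, vec_mul_self]
  simp

theorem gen_mul_gen {i j : Fin 7} (h : i < j) : gen j * gen i = -(gen i * gen j) := by
  rw [← add_eq_zero_iff_eq_neg, add_comm]
  have h1 := CliffordAlgebra.ι_mul_ι_add_swap_of_isOrtho (Q := cliffordForm)
    (a := EuclideanSpace.single i 1) (b := EuclideanSpace.single j 1) (by
      rw [QuadraticMap.isOrtho_def, cliffordForm_apply, cliffordForm_apply, cliffordForm_apply,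
        real_inner_add_add_self]
      simp [EuclideanSpace.inner_single_left, h.ne])
  exact h1

theorem gen_mul_self_left (i : Fin 7) (a : Cl7) : gen i * (gen i * a) = -a := by
  rw [← mul_assoc, gen_mul_self, neg_one_mul]

theorem gen_mul_gen_left {i j : Fin 7} (h : i < j) (a : Cl7) :
    gen j * (gen i * a) = -(gen i * (gen j * a)) := by
  rw [← mul_assoc, gen_mul_gen h, neg_mul, mul_assoc]

/-- `w` is fixed up to sign by the element `T` of the Clifford algebra. -/
def FixedUpToSign (T : Cl7) (w : Δ) : Prop := T • w = w ∨ T • w = -w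

theorem FixedUpToSign.mul {T T' : Cl7} {w : Δ} (h : FixedUpToSign T w) (h' : FixedUpToSign T' w) :
    FixedUpToSign (T * T') w := by
  unfold FixedUpToSign at *
  rw [mul_smul]
  rcases h with h | h <;> rcases h' with h' | h' <;> simp [h, h']

theorem FixedUpToSign.neg {T : Cl7} {w : Δ} (h : FixedUpToSign (-T) w) : FixedUpToSign T w := by
  unfold FixedUpToSign at *
  rw [neg_smul, neg_inj, neg_eq_iff_eq_neg] at h
  exact h.symm

/-- An involution `T` fixes a nonzero vector up to sign, and such a vector can be found without
disturbing the same property for involutions which commute with `T`. -/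
theorem exists_fixedUpToSign {T : Cl7} (hT : T * T = 1) {w : Δ} (hw : w ≠ 0) :
    ∃ w' : Δ, w' ≠ 0 ∧ FixedUpToSign T w' ∧
      ∀ T' : Cl7, T' * T = T * T' → FixedUpToSign T' w → FixedUpToSign T' w' := by
  by_cases h : T • w = -w
  · exact ⟨w, hw, Or.inr h, fun _ _ h' => h'⟩
  · refine ⟨w + T • w, fun h' => h (eq_neg_of_add_eq_zero_right h'), Or.inl ?_, ?_⟩
    · rw [smul_add, ← mul_smul, hT, one_smul, add_comm]
    · rintro T' hT' h'
      unfold FixedUpToSign at *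
      rw [smul_add, ← mul_smul, hT', mul_smul]
      rcases h' with h' | h'
      · exact Or.inl (by rw [h'])
      · exact Or.inr (by rw [h', smul_neg, neg_add])

set_option linter.unusedSimpArgs false in
/-- The lines of the Fano plane on the index set `{0, …, 6}`: a nonzero spinor can be found which
is fixed up to sign by `e_i e_j e_k` for every line `{i, j, k}`. Three of these products and
`e_0 ⋯ e_6` are commuting involutions; the other lines are products of them. -/
theorem exists_fano_spinor [Nontrivial Δ] : ∃ w : Δ, w ≠ 0 ∧
    FixedUpToSign (gen 0 * (gen 1 * gen 2)) w ∧ FixedUpToSign (gen 0 * (gen 3 * gen 4)) w ∧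
    FixedUpToSign (gen 1 * (gen 3 * gen 5)) w ∧ FixedUpToSign (gen 0 * (gen 5 * gen 6)) w ∧
    FixedUpToSign (gen 1 * (gen 4 * gen 6)) w ∧ FixedUpToSign (gen 2 * (gen 3 * gen 6)) w ∧
    FixedUpToSign (gen 2 * (gen 4 * gen 5)) w := by
  obtain ⟨w0, hw0⟩ := exists_ne (0 : Δ)
  set T1 : Cl7 := gen 0 * (gen 1 * gen 2) with hT1
  set T2 : Cl7 := gen 0 * (gen 3 * gen 4) with hT2
  set T3 : Cl7 := gen 1 * (gen 3 * gen 5) with hT3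
  set T4 : Cl7 := gen 0 * (gen 1 * (gen 2 * (gen 3 * (gen 4 * (gen 5 * gen 6))))) with hT4
  obtain ⟨w1, hw1, f1, -⟩ := exists_fixedUpToSign (T := T1) (by
    simp +decide [hT1, mul_assoc, gen_mul_self, gen_mul_gen, gen_mul_self_left,
      gen_mul_gen_left]) hw0
  obtain ⟨w2, hw2, f2, h2⟩ := exists_fixedUpToSign (T := T2) (by
    simp +decide [hT2, mul_assoc, gen_mul_self, gen_mul_gen, gen_mul_self_left,
      gen_mul_gen_left]) hw1
  obtain ⟨w3, hw3, f3, h3⟩ := exists_fixedUpToSign (T := T3) (by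
    simp +decide [hT3, mul_assoc, gen_mul_self, gen_mul_gen, gen_mul_self_left,
      gen_mul_gen_left]) hw2
  obtain ⟨w4, hw4, f4, h4⟩ := exists_fixedUpToSign (T := T4) (by
    simp +decide [hT4, mul_assoc, gen_mul_self, gen_mul_gen, gen_mul_self_left,
      gen_mul_gen_left]) hw3
  have c12 : T1 * T2 = T2 * T1 := by
    simp +decide [hT1, hT2, mul_assoc, gen_mul_self, gen_mul_gen, gen_mul_self_left,
      gen_mul_gen_left]
  have c13 : T1 * T3 = T3 * T1 := by
    simp +decide [hT1, hT3, mul_assoc, gen_mul_self, gen_mul_gen, gen_mul_self_left,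
      gen_mul_gen_left]
  have c23 : T2 * T3 = T3 * T2 := by
    simp +decide [hT2, hT3, mul_assoc, gen_mul_self, gen_mul_gen, gen_mul_self_left,
      gen_mul_gen_left]
  have c14 : T1 * T4 = T4 * T1 := by
    simp +decide [hT1, hT4, mul_assoc, gen_mul_self, gen_mul_gen, gen_mul_self_left,
      gen_mul_gen_left]
  have c24 : T2 * T4 = T4 * T2 := by
    simp +decide [hT2, hT4, mul_assoc, gen_mul_self, gen_mul_gen, gen_mul_self_left,
      gen_mul_gen_left]
  have c34 : T3 * T4 = T4 * T3 := by
    simp +decide [hT3, hT4, mul_assoc, gen_mul_self, gen_mul_gen, gen_mul_self_left,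
      gen_mul_gen_left]
  have g1 : FixedUpToSign T1 w4 := h4 _ c14 (h3 _ c13 (h2 _ c12 f1))
  have g2 : FixedUpToSign T2 w4 := h4 _ c24 (h3 _ c23 f2)
  have g3 : FixedUpToSign T3 w4 := h4 _ c34 f3
  have close : ∀ T T' : Cl7, FixedUpToSign T w4 → (T = T' ∨ T = -T') → FixedUpToSign T' w4 := by
    rintro T T' h (rfl | rfl)
    · exact h
    · exact h.neg
  refine ⟨w4, hw4, g1, g2, g3, close _ _ ((g1.mul g2).mul f4) ?_,
    close _ _ ((g1.mul g3).mul f4) ?_, close _ _ ((g2.mul g3).mul f4) ?_,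
    close _ _ ((g1.mul g2).mul g3) ?_⟩ <;>
  simp +decide [hT1, hT2, hT3, hT4, mul_assoc, gen_mul_self, gen_mul_gen, gen_mul_self_left,
      gen_mul_gen_left]

variable [InnerProductSpace ℝ Δ] [hΔ : IsSpinModule Δ]

/-- The linear map `(r, y) ↦ r v + y · v`. -/
noncomputable def spinorMap (v : Δ) : ℝ × E7 →ₗ[ℝ] Δ where
  toFun a := a.1 • v + vec a.2 • v
  map_add' a b := by
    rw [Prod.fst_add, Prod.snd_add, map_add, add_smul, add_smul]
    abel
  map_smul' r a := by
    have := hΔ.isScalarTower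
    rw [Prod.smul_fst, Prod.smul_snd, map_smul, smul_eq_mul, mul_smul, RingHom.id_apply, smul_add,
      smul_assoc r (vec a.2) v]

theorem spinorMap_apply (v : Δ) (r : ℝ) (y : E7) : spinorMap v (r, y) = r • v + vec y • v := rfl

theorem vec_smul_vec_smul_self (x : E7) (v : Δ) :
    vec x • vec x • v = -((inner ℝ x x : ℝ) • v) := by
  have := hΔ.isScalarTower
  rw [← mul_smul, vec_mul_self, algebraMap_smul, neg_smul]

theorem vec_real_smul_smul (x : E7) (r : ℝ) (v : Δ) : vec (r • x) • v = r • vec x • v := by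
  have := hΔ.isScalarTower
  rw [map_smul]
  exact smul_assoc r (vec x) v

theorem vec_smul_real_smul (x : E7) (r : ℝ) (v : Δ) : vec x • r • v = r • vec x • v := by
  have := hΔ.isScalarTower
  rw [← algebraMap_smul Cl7 r v, ← mul_smul, ← Algebra.commutes, mul_smul, algebraMap_smul]

theorem vec_smul_vec_smul_swap (x y : E7) (v : Δ) :
    vec x • vec y • v = -((2 * inner ℝ x y : ℝ) • v) - vec y • vec x • v := by
  have h := vec_smul_vec_smul_self (x + y) v
  rw [map_add, add_smul, add_smul, smul_add, smul_add, vec_smul_vec_smul_self x,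
    vec_smul_vec_smul_self y, real_inner_add_add_self] at h
  generalize vec x • vec y • v = a at *
  generalize vec y • vec x • v = b at *
  rw [← sub_eq_zero] at h ⊢
  rw [← h]
  module

/-- `Δ` is spanned by a spinor `w` and the spinors `e_i w` as soon as `w` is fixed up to sign by the
products belonging to the lines of a Fano plane. -/
theorem range_spinorMap_eq_top {w : Δ} (hw : w ≠ 0)
    (h : ∀ i j, i ≠ j → gen i • gen j • w ∈ LinearMap.range (spinorMap w)) :
    LinearMap.range (spinorMap w) = ⊤ := by
  have := hΔ.isScalarTower
  have := hΔ.isSimple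
  have hw0 : ∀ r : ℝ, r • w ∈ LinearMap.range (spinorMap w) := fun r =>
    ⟨(r, 0), by simp [spinorMap_apply]⟩
  have hvw : ∀ x, vec x • w ∈ LinearMap.range (spinorMap w) := fun x =>
    ⟨(0, x), by simp [spinorMap_apply]⟩
  have hbasis : ∀ x : E7, vec x = ∑ i, x i • gen i := by
    intro x
    conv_lhs => rw [← (EuclideanSpace.basisFun (Fin 7) ℝ).sum_repr x]
    simp [gen]
  have hgen : ∀ i j, gen i • gen j • w ∈ LinearMap.range (spinorMap w) := by
    intro i j
    by_cases hij : i = j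
    · rw [hij, gen, vec_smul_vec_smul_self]
      exact neg_mem (hw0 _)
    · exact h i j hij
  have hvv : ∀ x y, vec x • vec y • w ∈ LinearMap.range (spinorMap w) := by
    intro x y
    rw [hbasis x, Finset.sum_smul]
    refine Submodule.sum_mem _ fun i _ => ?_
    rw [smul_assoc]
    refine Submodule.smul_mem _ _ ?_
    rw [hbasis y, Finset.sum_smul, Finset.smul_sum]
    refine Submodule.sum_mem _ fun j _ => ?_
    rw [smul_assoc, gen, vec_smul_real_smul]
    exact Submodule.smul_mem _ _ (hgen i j)
  have hstep : ∀ x, ∀ u ∈ LinearMap.range (spinorMap w),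
      vec x • u ∈ LinearMap.range (spinorMap w) := by
    rintro x _ ⟨⟨r, y⟩, rfl⟩
    rw [spinorMap_apply, smul_add, vec_smul_real_smul]
    exact add_mem (Submodule.smul_mem _ _ (hvw x)) (hvv x y)
  have hcl : ∀ a : Cl7, ∀ u ∈ LinearMap.range (spinorMap w),
      a • u ∈ LinearMap.range (spinorMap w) := by
    intro a
    induction a using CliffordAlgebra.induction with
    | algebraMap r =>
      intro u hu
      rw [algebraMap_smul]
      exact Submodule.smul_mem _ _ hu
    | ι x => exact hstep x
    | mul a b ha hb => exact fun u hu => by rw [mul_smul]; exact ha _ (hb _ hu)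
    | add a b ha hb => exact fun u hu => by rw [add_smul]; exact add_mem (ha _ hu) (hb _ hu)
  let N : Submodule Cl7 Δ :=
    { (LinearMap.range (spinorMap w)).toAddSubmonoid with smul_mem' := fun a u hu => hcl a u hu }
  have hwN : w ∈ N := by
    have h1 := hw0 1
    rw [one_smul] at h1
    exact h1
  have hN : N = ⊤ := (eq_bot_or_eq_top N).resolve_left fun h => hw (by rw [h] at hwN; exact hwN)
  refine eq_top_iff.mpr fun u _ => ?_
  have : u ∈ N := hN ▸ Submodule.mem_top
  exact this

theorem mem_range_of_fano {w : Δ} {i j k : Fin 7} (hij : i < j) (hjk : j < k)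
    (h : FixedUpToSign (gen i * (gen j * gen k)) w) :
    (gen i • gen j • w ∈ LinearMap.range (spinorMap w)
      ∧ gen j • gen i • w ∈ LinearMap.range (spinorMap w)) ∧
    (gen i • gen k • w ∈ LinearMap.range (spinorMap w)
      ∧ gen k • gen i • w ∈ LinearMap.range (spinorMap w)) ∧
    (gen j • gen k • w ∈ LinearMap.range (spinorMap w)
      ∧ gen k • gen j • w ∈ LinearMap.range (spinorMap w)) := by
  have hgw : ∀ n, gen n • w ∈ LinearMap.range (spinorMap w) := fun n =>
    ⟨(0, EuclideanSpace.single n 1), by simp [spinorMap_apply, gen]⟩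
  have hswap : ∀ a b : Fin 7, a < b → gen a • gen b • w ∈ LinearMap.range (spinorMap w) →
      gen a • gen b • w ∈ LinearMap.range (spinorMap w)
      ∧ gen b • gen a • w ∈ LinearMap.range (spinorMap w) := by
    intro a b hab h
    refine ⟨h, ?_⟩
    rw [← mul_smul, gen_mul_gen hab, neg_smul, mul_smul]
    exact neg_mem h
  -- multiplying `e_i e_j e_k w = ± w` by a generator gives the three products of two generators
  have hT : ∀ n, gen n • (gen i * (gen j * gen k)) • w ∈ LinearMap.range (spinorMap w) := by
    intro n
    rcases h with h | h
    · rw [h]; exact hgw n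
    · rw [h, smul_neg]; exact neg_mem (hgw n)
  refine ⟨hswap i j hij ?_, hswap i k (hij.trans hjk) ?_, hswap j k hjk ?_⟩
  · have e : gen k * (gen i * (gen j * gen k)) = - (gen i * gen j) := by
      rw [gen_mul_gen_left (hij.trans hjk), gen_mul_gen_left hjk, gen_mul_self]
      simp
    have := hT k
    rw [← mul_smul, e, neg_smul, neg_mem_iff, mul_smul] at this
    exact this
  · have e : gen j * (gen i * (gen j * gen k)) = gen i * gen k := by
      rw [gen_mul_gen_left hij, gen_mul_self_left]
      simp
    have := hT j
    rw [← mul_smul, e, mul_smul] at this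
    exact this
  · have := hT i
    rw [← mul_smul, gen_mul_self_left, neg_smul, neg_mem_iff, mul_smul] at this
    exact this

theorem exists_range_spinorMap_eq_top :
    ∃ w : Δ, LinearMap.range (spinorMap w) = ⊤ := by
  have := hΔ.isSimple
  have : Nontrivial Δ := IsSimpleModule.nontrivial Cl7 Δ
  obtain ⟨w, hw, h012, h034, h135, h056, h146, h236, h245⟩ := exists_fano_spinor (Δ := Δ)
  refine ⟨w, range_spinorMap_eq_top hw ?_⟩
  have f1 := mem_range_of_fano (by decide) (by decide) h012
  have f2 := mem_range_of_fano (by decide) (by decide) h034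
  have f3 := mem_range_of_fano (by decide) (by decide) h135
  have f4 := mem_range_of_fano (by decide) (by decide) h056
  have f5 := mem_range_of_fano (by decide) (by decide) h146
  have f6 := mem_range_of_fano (by decide) (by decide) h236
  have f7 := mem_range_of_fano (by decide) (by decide) h245
  intro i j hij
  fin_cases i <;> fin_cases j <;> first
    | exact absurd rfl hij
    | (simp only [Fin.zero_eta, Fin.mk_one, Fin.reduceFinMk]
       simp only [f1, f2, f3, f4, f5, f6, f7])

theorem inner_vec_smul_vec_smul (x y : E7) (v : Δ) :
    inner ℝ (vec x • v) (vec y • v) = inner ℝ x y * inner ℝ v v := by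
  have h1 : ∀ x : E7, inner ℝ (vec x • v) (vec x • v) = inner ℝ x x * inner ℝ v v := by
    intro x
    rw [hΔ.inner_vec_smul, vec_smul_vec_smul_self, inner_neg_right, neg_neg, real_inner_smul_right]
  have h := h1 (x + y)
  rw [map_add, add_smul, real_inner_add_add_self, real_inner_add_add_self, h1, h1] at h
  linarith

/-- For a unit spinor `v` the map `(r, y) ↦ r v + y · v` is an isomorphism `ℝ ⊕ ℝ⁷ ≅ Δ`: it is
isometric, and `Δ` has dimension at most `8`. -/
theorem bijective_spinorMap {v : Δ} (hv : ‖v‖ = 1) : Function.Bijective (spinorMap v) := by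
  have hvv : inner ℝ v v = (1 : ℝ) := by rw [real_inner_self_eq_norm_sq, hv, one_pow]
  obtain ⟨w, hw⟩ := exists_range_spinorMap_eq_top (Δ := Δ)
  have : FiniteDimensional ℝ Δ := Module.Finite.of_surjective _ (LinearMap.range_eq_top.mp hw)
  have hinj : Function.Injective (spinorMap v) := by
    rw [← LinearMap.ker_eq_bot, LinearMap.ker_eq_bot']
    rintro ⟨r, y⟩ h
    have h1 : inner ℝ (spinorMap v (r, y)) (spinorMap v (r, y)) = r * r + inner ℝ y y := by
      rw [spinorMap_apply, real_inner_add_add_self, inner_vec_smul_vec_smul, real_inner_smul_left,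
        real_inner_smul_left, real_inner_smul_right, real_inner_comm (vec y • v) v, inner_vec_self,
        hvv]
      ring
    rw [h, inner_zero_left] at h1
    have h2 := real_inner_self_nonneg (F := E7) (x := y)
    have h3 : inner ℝ y y = (0 : ℝ) := by nlinarith [mul_self_nonneg r]
    have h4 : r = 0 := by
      have : r * r = 0 := by linarith
      exact mul_self_eq_zero.mp this
    rw [h4, inner_self_eq_zero.mp h3]
    rfl
  have h8 : finrank ℝ (ℝ × E7) = 8 := by
    rw [finrank_prod, finrank_self, finrank_euclideanSpace_fin]
  have h1 : finrank ℝ Δ ≤ finrank ℝ (ℝ × E7) :=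
    LinearMap.finrank_le_finrank_of_surjective (LinearMap.range_eq_top.mp hw)
  have h2 := LinearMap.finrank_le_finrank_of_injective hinj
  exact ⟨hinj, (LinearMap.injective_iff_surjective_of_finrank_eq_finrank (le_antisymm h2 h1)).mp
    hinj⟩

/-- The three-form of a unit spinor `v` is the three-form of a cross product, namely of the one
defined by `x · y · v = - ⟨x, y⟩ v - (x × y) · v`. -/
theorem exists_isCrossForm {v : Δ} (hv : ‖v‖ = 1) :
    ∃ B, IsCrossForm B (frameForm (LinearEquiv.refl ℝ E7) v) := by
  have := hΔ.isScalarTower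
  have hvv : inner ℝ v v = (1 : ℝ) := by rw [real_inner_self_eq_norm_sq, hv, one_pow]
  have hvec : ∀ y : E7, inner ℝ (vec y • v) v = (0 : ℝ) := fun y => inner_vec_self y v
  let F := LinearEquiv.ofBijective (spinorMap v) (bijective_spinorMap hv)
  let B : E7 →ₗ[ℝ] E7 →ₗ[ℝ] E7 := LinearMap.mk₂ ℝ (fun x y => -(F.symm (vec x • vec y • v)).2)
    (fun x x' y => by rw [map_add, add_smul, map_add, Prod.snd_add, neg_add])
    (fun r x y => by rw [vec_real_smul_smul, map_smul F.symm, Prod.smul_snd, smul_neg])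
    (fun x y y' => by rw [map_add, add_smul, smul_add, map_add, Prod.snd_add, neg_add])
    (fun r x y => by
      rw [vec_real_smul_smul, vec_smul_real_smul, map_smul F.symm, Prod.smul_snd, smul_neg])
  have hB : ∀ x y, vec x • vec y • v = -((inner ℝ x y : ℝ) • v) - vec (B x y) • v := by
    intro x y
    obtain ⟨⟨r, z⟩, hz⟩ := F.surjective (vec x • vec y • v)
    have h1 : B x y = -z := by
      change -(F.symm (vec x • vec y • v)).2 = -z
      rw [← hz, F.symm_apply_apply]
    have h2 : r • v + vec z • v = vec x • vec y • v := hz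
    have h3 := congrArg (fun u => inner ℝ u v) h2
    simp only [inner_add_left, real_inner_smul_left, hvv, hvec, hΔ.inner_vec_smul x] at h3
    rw [real_inner_comm, inner_vec_smul_vec_smul, hvv] at h3
    have h4 : r = - inner ℝ x y := by linarith
    rw [← h2, h1, h4, map_neg, neg_smul, neg_smul, sub_neg_eq_add]
  have hinj : ∀ y z : E7, vec y • v = vec z • v → y = z := by
    intro y z h
    have : spinorMap v (0, y) = spinorMap v (0, z) := by
      rw [spinorMap_apply, spinorMap_apply, h]
    exact congrArg Prod.snd ((bijective_spinorMap hv).1 this)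
  have hswap : ∀ x y, B x y = - B y x := by
    intro x y
    apply hinj
    have h := vec_smul_vec_smul_swap x y v
    rw [hB x y, hB y x, real_inner_comm x y] at h
    rw [map_neg, neg_smul]
    generalize vec (B x y) • v = a at *
    generalize vec (B y x) • v = b at *
    rw [← sub_eq_zero] at h ⊢
    rw [← neg_eq_zero, ← h]
    module
  have hform : ∀ x y z, frameForm (LinearEquiv.refl ℝ E7) v ![x, y, z] = inner ℝ (B x y) z := by
    intro x y z
    rw [frameForm_apply, hΔ.inner_vec_smul, hΔ.inner_vec_smul, neg_neg]
    change inner ℝ (vec z • v) (vec y • vec x • v) = _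
    rw [hB, inner_sub_right, inner_neg_right, real_inner_smul_right, hvec,
      inner_vec_smul_vec_smul, hvv, hswap y x, inner_neg_right, real_inner_comm z]
    ring
  refine ⟨B, ⟨⟨hswap, ?_, ?_⟩, hform⟩⟩
  · intro x y z
    rw [← hform, real_inner_comm, ← hform,
      ← (frameForm (LinearEquiv.refl ℝ E7) v).map_swap _ (show (1 : Fin 3) ≠ 2 by decide)]
    congr 1; ext i; fin_cases i <;> rfl
  · intro x y
    apply hinj
    have h1 := vec_smul_vec_smul_self x (vec y • v)
    have h2 : inner ℝ x (B x y) = (0 : ℝ) := by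
      rw [real_inner_comm, ← hform]
      exact (frameForm (LinearEquiv.refl ℝ E7) v).map_eq_zero_of_eq _ (i := 0) (j := 2) rfl
        (by decide)
    rw [hB x y, smul_sub, smul_neg, vec_smul_real_smul, hB x (B x y), h2] at h1
    rw [map_sub, sub_smul, vec_real_smul_smul, vec_real_smul_smul]
    generalize vec (B x (B x y)) • v = a at *
    generalize vec x • v = b at *
    generalize vec y • v = c at *
    rw [← sub_eq_zero] at h1 ⊢
    rw [← h1]
    module

end Spin

/-! ### Three-forms and metrics in a frame -/

section Frame

variable {V : Type*} [AddCommGroup V] [Module ℝ V]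

theorem compLinearMap_vec3 {W : Type*} [AddCommGroup W] [Module ℝ W] (φ : ThreeForm W)
    (A : V →ₗ[ℝ] W) (x y z : V) : φ.compLinearMap A ![x, y, z] = φ ![A x, A y, A z] := by
  rw [AlternatingMap.compLinearMap_apply]
  congr 1; ext i; fin_cases i <;> rfl

theorem formDeriv_compLinearMap {W : Type*} [AddCommGroup W] [Module ℝ W] (φ : ThreeForm W)
    (A : V →ₗ[ℝ] W) (a : W →ₗ[ℝ] W) (b : V →ₗ[ℝ] V) (hab : A ∘ₗ b = a ∘ₗ A) :
    formDeriv (φ.compLinearMap A) b = (formDeriv φ a).compLinearMap A := by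
  have h : ∀ x, A (b x) = a (A x) := fun x => LinearMap.congr_fun hab x
  refine ThreeForm.ext3 fun x y z => ?_
  simp only [formDeriv_apply, compLinearMap_vec3, h]

theorem frameMetric_nondegenerate (p : E7 ≃ₗ[ℝ] V) : (frameMetric p).Nondegenerate := by
  constructor
  · intro X hX
    have h := hX X
    rw [frameMetric_apply, inner_self_eq_zero] at h
    simpa using h
  · intro X hX
    have h := hX X
    rw [frameMetric_apply, inner_self_eq_zero] at h
    simpa using h

theorem isSymmetric_of_isSymm (p : E7 ≃ₗ[ℝ] V) {h : LinearMap.BilinForm ℝ V} (hh : h.IsSymm)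
    {S : E7 →ₗ[ℝ] E7} (hS : ∀ x y, h (p x) (p y) = inner ℝ (S x) y) : S.IsSymmetric :=
  fun x y => by
    rw [← hS, real_inner_comm (S y) x, ← hS]
    exact hh.eq _ _

/-- The bilinear form with matrix `S` in the frame `p`. -/
noncomputable def frameBilin (p : E7 ≃ₗ[ℝ] V) (S : E7 →ₗ[ℝ] E7) : LinearMap.BilinForm ℝ V :=
  (innerₗ E7).compl₁₂ (S ∘ₗ p.symm.toLinearMap) p.symm.toLinearMap

theorem frameBilin_apply (p : E7 ≃ₗ[ℝ] V) (S : E7 →ₗ[ℝ] E7) (X Y : V) :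
    frameBilin p S X Y = inner ℝ (S (p.symm X)) (p.symm Y) := rfl

theorem frameBilin_frame (p : E7 ≃ₗ[ℝ] V) (S : E7 →ₗ[ℝ] E7) (x y : E7) :
    frameBilin p S (p x) (p y) = inner ℝ (S x) y := by
  rw [frameBilin_apply, p.symm_apply_apply, p.symm_apply_apply]

theorem frameBilin_isSymm (p : E7 ≃ₗ[ℝ] V) {S : E7 →ₗ[ℝ] E7} (hS : S.IsSymmetric) :
    (frameBilin p S).IsSymm :=
  ⟨fun X Y => by
    rw [frameBilin_apply, frameBilin_apply, hS, real_inner_comm]⟩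

variable {Δ : Type*} [NormedAddCommGroup Δ] [InnerProductSpace ℝ Δ] [Module Cl7 Δ]
  [hΔ : IsSpinModule Δ]

theorem frameForm_eq_comp (p : E7 ≃ₗ[ℝ] V) (v : Δ) :
    frameForm p v = (frameForm (LinearEquiv.refl ℝ E7) v).compLinearMap p.symm.toLinearMap :=
  rfl

theorem frameForm_vec3 (p : E7 ≃ₗ[ℝ] V) (v : Δ) (X Y Z : V) : frameForm p v ![X, Y, Z]
    = frameForm (LinearEquiv.refl ℝ E7) v ![p.symm X, p.symm Y, p.symm Z] := by
  rw [frameForm_apply, frameForm_apply]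
  rfl

/-- The three-form of a unit spinor determines its metric. -/
theorem frameMetric_eq_of_frameForm_eq {p p' : E7 ≃ₗ[ℝ] V} {v v' : Δ} (hv : ‖v‖ = 1)
    (hv' : ‖v'‖ = 1) (h : frameForm p v = frameForm p' v') : frameMetric p = frameMetric p' := by
  obtain ⟨B, hB⟩ := exists_isCrossForm hv
  obtain ⟨B', hB'⟩ := exists_isCrossForm hv'
  let q : E7 ≃ₗ[ℝ] E7 := p.trans p'.symm
  have hq : ∀ x y z, inner ℝ (B' (q x) (q y)) (q z) = inner ℝ (B x y) z := by
    intro x y z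
    have e := DFunLike.congr_fun h ![p x, p y, p z]
    rw [frameForm_vec3 p, frameForm_vec3 p', hB.apply_eq, hB'.apply_eq] at e
    simpa [q] using e.symm
  refine LinearMap.ext₂ fun X Y => ?_
  rw [frameMetric_apply, frameMetric_apply,
    ← hB.isometry_of_map_form hB'.toIsCrossProduct q hq]
  simp [q]

variable [FiniteDimensional ℝ V]

theorem iMap_eq_formDeriv (g : LinearMap.BilinForm ℝ V) (φ : ThreeForm V)
    (h : LinearMap.BilinForm ℝ V) : iMap g φ h = (1 / 3 : ℝ) • formDeriv φ (raise g h) := by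
  refine ThreeForm.ext3 fun x y z => ?_
  rw [iMap, AlternatingMap.smul_apply, AlternatingMap.smul_apply, alternatization_insert_apply,
    formDeriv_apply, smul_eq_mul, smul_eq_mul]
  ring

theorem frameMetric_raise (p : E7 ≃ₗ[ℝ] V) (h : LinearMap.BilinForm ℝ V) (X Y : V) :
    frameMetric p (raise (frameMetric p) h X) Y = h X Y := by
  rw [raise, dif_pos (frameMetric_nondegenerate p)]
  exact LinearMap.BilinForm.apply_toDual_symm_apply (hB := frameMetric_nondegenerate p) _ _

/-- In the frame `p` the endomorphism `h♯` has the matrix of `h`. -/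
theorem raise_frameMetric (p : E7 ≃ₗ[ℝ] V) {h : LinearMap.BilinForm ℝ V} {S : E7 →ₗ[ℝ] E7}
    (hS : ∀ x y, h (p x) (p y) = inner ℝ (S x) y) :
    p.symm.toLinearMap ∘ₗ raise (frameMetric p) h = S ∘ₗ p.symm.toLinearMap := by
  ext1 X
  refine ext_inner_right ℝ fun y => ?_
  have e := frameMetric_raise p h X (p y)
  rw [frameMetric_apply, p.symm_apply_apply] at e
  have e2 := hS (p.symm X) y
  rw [p.apply_symm_apply] at e2
  change inner ℝ (p.symm (raise (frameMetric p) h X)) y = inner ℝ (S (p.symm X)) y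
  rw [e, e2]

/-- Every bilinear form is given by an endomorphism in the frame `p`. -/
theorem exists_endomorphism (p : E7 ≃ₗ[ℝ] V) (h : LinearMap.BilinForm ℝ V) :
    ∃ S : E7 →ₗ[ℝ] E7, ∀ x y, h (p x) (p y) = inner ℝ (S x) y := by
  refine ⟨p.symm.toLinearMap ∘ₗ raise (frameMetric p) h ∘ₗ p.toLinearMap, fun x y => ?_⟩
  rw [← frameMetric_raise p h, frameMetric_apply, p.symm_apply_apply]
  rfl

/-- The map `i_ω` in a frame is a third of the infinitesimal action of `𝔤𝔩(7)`. -/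
theorem iMap_frame (p : E7 ≃ₗ[ℝ] V) (v : Δ) {h : LinearMap.BilinForm ℝ V} {S : E7 →ₗ[ℝ] E7}
    (hS : ∀ x y, h (p x) (p y) = inner ℝ (S x) y) :
    iMap (frameMetric p) (frameForm p v) h = (1 / 3 : ℝ) •
      (formDeriv (frameForm (LinearEquiv.refl ℝ E7) v) S).compLinearMap p.symm.toLinearMap := by
  rw [iMap_eq_formDeriv, frameForm_eq_comp,
    formDeriv_compLinearMap _ _ _ _ (raise_frameMetric p hS)]

theorem injOn_iMap_frame (p : E7 ≃ₗ[ℝ] V) {v : Δ} (hv : ‖v‖ = 1) :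
    Set.InjOn (iMap (frameMetric p) (frameForm p v)) {h | h.IsSymm} := by
  intro h hh h' hh' e
  obtain ⟨B, hB⟩ := exists_isCrossForm hv
  obtain ⟨S, hS⟩ := exists_endomorphism p h
  obtain ⟨S', hS'⟩ := exists_endomorphism p h'
  rw [iMap_frame p v hS, iMap_frame p v hS'] at e
  have e1 : formDeriv (frameForm (LinearEquiv.refl ℝ E7) v) (S - S') = 0 := by
    rw [map_sub, sub_eq_zero]
    refine ThreeForm.ext3 fun x y z => ?_
    have e2 := DFunLike.congr_fun (smul_right_injective _ (by norm_num : (1 / 3 : ℝ) ≠ 0) e)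
      ![p x, p y, p z]
    simpa only [compLinearMap_vec3, LinearEquiv.coe_coe, p.symm_apply_apply] using e2
  have e3 := hB.eq_zero_of_formDeriv_eq_zero
    ((isSymmetric_of_isSymm p hh hS).sub (isSymmetric_of_isSymm p hh' hS')) e1
  rw [sub_eq_zero] at e3
  refine LinearMap.ext₂ fun X Y => ?_
  have e4 := hS (p.symm X) (p.symm Y)
  rw [e3, ← hS'] at e4
  simpa using e4

end Frame

/-! ### The spinor bundle in a frame -/

section Bundle

variable {M : Type*} [TopologicalSpace M] [ChartedSpace E7 M] [IsManifold (𝓡 7) ∞ M]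
  {o : OrientedFrames M} {P : SpinStructure o} {Δ : Type*} [NormedAddCommGroup Δ]
  [Module Cl7 Δ] {x : M}

theorem Spinor.exists_mk (s : Spinor P Δ x) : ∃ σ v, s = Spinor.mk σ v := by
  induction s using Quotient.inductionOn with
  | h a => exact ⟨a.1, a.2, rfl⟩

variable (P) in
theorem exists_toFrame_eq {p : E7 ≃ₗ[ℝ] TangentSpace (𝓡 7) x}
    (hp : (⟨x, p⟩ : FrameBundle M) ∈ o.carrier) : ∃ σ : P.fib x, P.toFrame σ = p := by
  have h := P.two_sheets x p hp
  have : Nonempty {σ : P.fib x // P.toFrame σ = p} :=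
    (Nat.card_pos_iff.mp (by rw [h]; norm_num)).1
  obtain ⟨σ⟩ := this
  exact ⟨σ.1, σ.2⟩

variable [InnerProductSpace ℝ Δ] [hΔ : IsSpinModule Δ]

theorem image_form_unitSpinors : Spinor.form '' unitSpinors P Δ x = positiveForms P Δ x := by
  ext φ
  constructor
  · rintro ⟨s, hs, rfl⟩
    refine ⟨s, hs, LinearEquiv.refl ℝ _, ?_, ?_⟩
    · rw [LinearEquiv.refl_toLinearMap, LinearMap.det_id]
      exact one_pos
    · rfl
  · rintro ⟨s, hs, A, hA, rfl⟩
    obtain ⟨σ, v, rfl⟩ := s.exists_mk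
    have hmem : (⟨x, (P.toFrame σ).trans A.symm⟩ : FrameBundle M) ∈ o.carrier := by
      refine (o.mem_iff x (P.toFrame σ) _ (P.toFrame_mem σ)).mpr ?_
      have h1 : (((P.toFrame σ).trans A.symm).trans (P.toFrame σ).symm).toLinearMap
          = (P.toFrame σ).symm.toLinearMap ∘ₗ A.symm.toLinearMap ∘ₗ
            (P.toFrame σ).symm.symm.toLinearMap := rfl
      rw [h1, LinearMap.det_conj]
      have h2 : LinearMap.det A.symm.toLinearMap * LinearMap.det A.toLinearMap = 1 := by
        rw [← LinearMap.det_comp, LinearEquiv.symm_comp, LinearMap.det_id]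
      exact pos_of_mul_pos_left (h2 ▸ one_pos) hA.le
    obtain ⟨τ, hτ⟩ := exists_toFrame_eq P hmem
    refine ⟨Spinor.mk τ v, hs, ?_⟩
    rw [Spinor.form_mk, Spinor.form_mk, hτ]
    rfl

/-- In a frame `p` which together with a unit spinor `v` gives the three-form `φ`, the space
`Λ³₂₈(φ)` consists of the derivatives of `φ` in the directions of symmetric endomorphisms. -/
theorem mem_Lambda28_iff {p : E7 ≃ₗ[ℝ] TangentSpace (𝓡 7) x} {v : Δ} (hv : ‖v‖ = 1)
    (hp : frameForm p v ∈ positiveForms P Δ x) (η : ThreeForm (TangentSpace (𝓡 7) x)) :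
    η ∈ Lambda28 P Δ (frameForm p v) ↔ ∃ S : E7 →ₗ[ℝ] E7, S.IsSymmetric ∧
      η = (formDeriv (frameForm (LinearEquiv.refl ℝ E7) v) S).compLinearMap
        p.symm.toLinearMap := by
  have hmetric : ∀ s ∈ unitSpinors P Δ x, s.form = frameForm p v → s.metric = frameMetric p := by
    intro s hs h
    obtain ⟨σ, v', rfl⟩ := s.exists_mk
    exact frameMetric_eq_of_frameForm_eq hs hv h
  constructor
  · rintro ⟨g, h, ⟨s, hs, rfl, hform⟩, hh, rfl⟩
    rw [hmetric s hs hform]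
    obtain ⟨S, hS⟩ := exists_endomorphism p h
    refine ⟨(1 / 3 : ℝ) • S, (isSymmetric_of_isSymm p hh hS).smul (by simp), ?_⟩
    rw [iMap_frame p v hS, map_smul]
    rfl
  · rintro ⟨S, hS, rfl⟩
    rw [← image_form_unitSpinors] at hp
    obtain ⟨s, hs, hform⟩ := hp
    refine ⟨s.metric, frameBilin p ((3 : ℝ) • S), ⟨s, hs, rfl, hform⟩,
      frameBilin_isSymm p (hS.smul (by simp)), ?_⟩
    rw [hmetric s hs hform, iMap_frame p v (frameBilin_frame p _), map_smul]
    refine ThreeForm.ext3 fun X Y Z => ?_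
    rw [AlternatingMap.smul_apply, compLinearMap_vec3, compLinearMap_vec3,
      AlternatingMap.smul_apply, smul_eq_mul, smul_eq_mul]
    ring

end Bundle

/-! ### Integral manifolds of the distribution of symmetric endomorphisms -/

section Integral

/-- A linear functional on three-forms is a combination of evaluations at basis vectors. -/
theorem exists_eq_sum_eval (l : ThreeForm E7 →ₗ[ℝ] ℝ) : ∃ c : (Fin 3 → Fin 7) → ℝ,
    ∀ α : ThreeForm E7, l α = ∑ I, c I * α ![EuclideanSpace.single (I 0) 1,
      EuclideanSpace.single (I 1) 1, EuclideanSpace.single (I 2) 1] := by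
  classical
  let ev : ThreeForm E7 →ₗ[ℝ] ((Fin 3 → Fin 7) → ℝ) :=
    { toFun := fun α I => α ![EuclideanSpace.single (I 0) 1,
        EuclideanSpace.single (I 1) 1, EuclideanSpace.single (I 2) 1]
      map_add' := fun α β => rfl
      map_smul' := fun r α => rfl }
  have hev : LinearMap.ker ev = ⊥ := by
    rw [LinearMap.ker_eq_bot']
    intro α hα
    refine Basis.ext_alternating (EuclideanSpace.basisFun (Fin 7) ℝ).toBasis fun I _ => ?_
    rw [eq_vec3 (fun i => (EuclideanSpace.basisFun (Fin 7) ℝ).toBasis (I i))]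
    simpa [ev] using congrFun hα I
  obtain ⟨r, hr⟩ := LinearMap.exists_leftInverse_of_injective ev hev
  refine ⟨fun I => l (r (Pi.single I 1)), fun α => ?_⟩
  have h1 : α = r (ev α) := (LinearMap.congr_fun hr α).symm
  have h2 : ev α = ∑ I, (ev α I) • (Pi.single I 1 : (Fin 3 → Fin 7) → ℝ) := by
    ext J
    simp [Finset.sum_apply, Pi.single_apply]
  conv_lhs => rw [h1, h2, map_sum, map_sum]
  refine Finset.sum_congr rfl fun I _ => ?_
  rw [map_smul, map_smul, smul_eq_mul, mul_comm]
  rfl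

variable {B : E7 →ₗ[ℝ] E7 →ₗ[ℝ] E7} {φ : ThreeForm E7}

theorem IsCrossForm.hasFDerivAt_eval (hB : IsCrossForm B φ) {F : Type*} [NormedAddCommGroup F]
    [NormedSpace ℝ F] {A : F → E7 →L[ℝ] E7} {A' : F →L[ℝ] E7 →L[ℝ] E7} {u : F}
    (hA : HasFDerivAt A A' u) (x y z : E7) :
    ∃ D : F →L[ℝ] ℝ, HasFDerivAt (fun u => φ ![A u x, A u y, A u z]) D u ∧
      ∀ w, D w = φ ![A' w x, A u y, A u z] + φ ![A u x, A' w y, A u z]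
        + φ ![A u x, A u y, A' w z] := by
  let Bc : E7 →L[ℝ] E7 →L[ℝ] E7 :=
    LinearMap.toContinuousLinearMap (LinearMap.toContinuousLinearMap.toLinearMap ∘ₗ B)
  have hBc : ∀ x y, B x y = Bc x y := fun _ _ => rfl
  simp only [hB.apply_eq, hBc]
  have h := fun x : E7 => hA.clm_apply (hasFDerivAt_const x u)
  refine ⟨_, (Bc.hasFDerivAt_of_bilinear (h x) (h y)).inner ℝ (h z), fun w => ?_⟩
  simp [inner_add_left]
  ring

theorem IsCrossForm.contDiff_comp (hB : IsCrossForm B φ) (l : ThreeForm E7 →ₗ[ℝ] ℝ) :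
    ContDiff ℝ ∞ (fun A : E7 →L[ℝ] E7 => l (φ.compLinearMap A.toLinearMap)) := by
  obtain ⟨c, hc⟩ := exists_eq_sum_eval l
  let Bc : E7 →L[ℝ] E7 →L[ℝ] E7 :=
    LinearMap.toContinuousLinearMap (LinearMap.toContinuousLinearMap.toLinearMap ∘ₗ B)
  have hBc : ∀ x y, B x y = Bc x y := fun _ _ => rfl
  simp only [hc, compLinearMap_vec3, hB.apply_eq, hBc, ContinuousLinearMap.coe_coe]
  exact ContDiff.sum fun I _ => contDiff_const.mul (ContDiff.inner ℝ (by fun_prop) (by fun_prop))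

/-- At the identity the derivative of the action of `GL(7)` on `φ` is `formDeriv φ`. -/
theorem IsCrossForm.hasFDerivAt_comp_one (hB : IsCrossForm B φ) (l : ThreeForm E7 →ₗ[ℝ] ℝ) :
    ∃ D : (E7 →L[ℝ] E7) →L[ℝ] ℝ,
      HasFDerivAt (fun A : E7 →L[ℝ] E7 => l (φ.compLinearMap A.toLinearMap)) D 1 ∧
      ∀ a, D a = l (formDeriv φ a.toLinearMap) := by
  obtain ⟨c, hc⟩ := exists_eq_sum_eval l
  choose D hD hD' using fun x y z : E7 =>
    hB.hasFDerivAt_eval (hasFDerivAt_id (𝕜 := ℝ) (1 : E7 →L[ℝ] E7)) x y z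
  simp only [hc, compLinearMap_vec3, formDeriv_apply]
  refine ⟨_, HasFDerivAt.fun_sum fun I _ => (hD _ _ _).const_mul (c I), fun a => ?_⟩
  simp [hD']

/-- The forms near `φ` are pull-backs of `φ` by endomorphisms which depend smoothly on the form,
by the inverse function theorem: the derivative `formDeriv φ` of the action is surjective. -/
theorem IsCrossForm.exists_smooth_lift (hB : IsCrossForm B φ) {F : Type*} [NormedAddCommGroup F]
    [NormedSpace ℝ F] {f : F → ThreeForm E7} {u₀ : F} (h0 : f u₀ = φ)
    (hf : ∀ X, ContDiffAt ℝ ∞ (fun u => f u X) u₀) :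
    ∃ A : F → E7 →L[ℝ] E7, ContDiffAt ℝ ∞ A u₀ ∧ A u₀ = 1 ∧
      ∀ᶠ u in 𝓝 u₀, f u = φ.compLinearMap (A u).toLinearMap := by
  have hfin : FiniteDimensional ℝ (ThreeForm E7) :=
    FiniteDimensional.of_finrank_pos (by rw [finrank_threeForm]; norm_num)
  obtain ⟨R, hR⟩ := LinearMap.exists_rightInverse_of_surjective _ hB.range_formDeriv
  let b := (finBasis ℝ (ThreeForm E7)).equivFun
  let n := finrank ℝ (ThreeForm E7)
  let ρ : (Fin n → ℝ) →L[ℝ] E7 →L[ℝ] E7 := LinearMap.toContinuousLinearMap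
    (LinearMap.toContinuousLinearMap.toLinearMap ∘ₗ R ∘ₗ b.symm.toLinearMap)
  have hρ : ∀ y, formDeriv φ (ρ y).toLinearMap = b.symm y := fun y =>
    LinearMap.congr_fun hR (b.symm y)
  let co : Fin n → ThreeForm E7 →ₗ[ℝ] ℝ := fun i => LinearMap.proj i ∘ₗ b.toLinearMap
  let G : (Fin n → ℝ) → (Fin n → ℝ) := fun y => b (φ.compLinearMap (1 + ρ y).toLinearMap)
  have hG : ContDiff ℝ ∞ G := by
    rw [contDiff_pi]
    intro i
    exact (hB.contDiff_comp (co i)).comp (contDiff_const.add ρ.contDiff)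
  have hG' : HasFDerivAt G
      ((ContinuousLinearEquiv.refl ℝ (Fin n → ℝ) : (Fin n → ℝ) ≃L[ℝ] (Fin n → ℝ)) :
        (Fin n → ℝ) →L[ℝ] (Fin n → ℝ)) 0 := by
    rw [hasFDerivAt_pi']
    intro i
    obtain ⟨D, hD, hD'⟩ := hB.hasFDerivAt_comp_one (co i)
    have h1 : HasFDerivAt (fun y => 1 + ρ y) ρ 0 := ρ.hasFDerivAt.const_add 1
    have h2 : (1 : E7 →L[ℝ] E7) = 1 + ρ 0 := by rw [map_zero, add_zero]
    rw [h2] at hD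
    refine (hD.comp (0 : Fin n → ℝ) h1).congr_fderiv ?_
    ext1 y
    change D (ρ y) = y i
    rw [hD', hρ]
    change b (b.symm y) i = y i
    rw [b.apply_symm_apply]
  have hG0 : G 0 = b φ := by
    change b (φ.compLinearMap (1 + ρ 0).toLinearMap) = b φ
    rw [map_zero, add_zero]
    rfl
  have hn : (∞ : WithTop ℕ∞) ≠ 0 := by simp
  let Gi := hG.contDiffAt.localInverse hG' hn
  have hGi : ContDiffAt ℝ ∞ Gi (G 0) := hG.contDiffAt.to_localInverse hG' hn
  have hGi0 : Gi (G 0) = 0 := hG.contDiffAt.localInverse_apply_image hG' hn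
  have hGi' : ∀ᶠ y in 𝓝 (G 0), G (Gi y) = y :=
    (hG.contDiffAt.hasStrictFDerivAt' hG' hn).eventually_right_inverse
  have hbf : ContDiffAt ℝ ∞ (fun u => b (f u)) u₀ := by
    rw [contDiffAt_pi]
    intro i
    obtain ⟨c, hc⟩ := exists_eq_sum_eval (co i)
    change ContDiffAt ℝ ∞ (fun u => co i (f u)) u₀
    simp only [hc]
    exact ContDiffAt.sum fun I _ => contDiffAt_const.mul (hf _)
  have hb0 : b (f u₀) = G 0 := by rw [h0, hG0]
  have hGf : ContDiffAt ℝ ∞ (fun u => Gi (b (f u))) u₀ :=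
    ContDiffAt.comp u₀ (by rw [hb0]; exact hGi) hbf
  refine ⟨fun u => 1 + ρ (Gi (b (f u))), contDiffAt_const.add (ρ.contDiff.contDiffAt.comp u₀ hGf),
    ?_, ?_⟩
  · simp only [hb0, hGi0, map_zero, add_zero]
  · have h1 := hbf.continuousAt.eventually (p := fun y => G (Gi y) = y) (by
      change ∀ᶠ y in 𝓝 (b (f u₀)), G (Gi y) = y
      rw [hb0]
      exact hGi')
    filter_upwards [h1] with u hu
    exact b.injective hu.symm

/-- A form of the Maurer–Cartan equation: if a linear functional `m` vanishes on the values of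
`dA · A⁻¹`, then it vanishes on the commutators of these values. This expresses the symmetry of the
second derivative of `A`. -/
theorem map_commutator_eq_zero {F R : Type*} [NormedAddCommGroup F] [NormedSpace ℝ F] [NormedRing R]
    [NormedAlgebra ℝ R] [CompleteSpace R] {A : F → R} {u₀ : F} (hA : ContDiffAt ℝ ∞ A u₀)
    (hA1 : A u₀ = 1) (m : R →L[ℝ] ℝ)
    (hm : ∀ w, ∀ᶠ u in 𝓝 u₀, m (fderiv ℝ A u w * Ring.inverse (A u)) = 0) (w w' : F) :
    m (fderiv ℝ A u₀ w * fderiv ℝ A u₀ w' - fderiv ℝ A u₀ w' * fderiv ℝ A u₀ w) = 0 := by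
  have h2 : (2 : WithTop ℕ∞) ≤ ∞ := WithTop.coe_le_coe.mpr le_top
  have hd2 : HasFDerivAt (fderiv ℝ A) (fderiv ℝ (fderiv ℝ A) u₀) u₀ := by
    exact ((hA.fderiv_right (m := 1) (by rw [one_add_one_eq_two]; exact h2)).differentiableAt (by simp)).hasFDerivAt
  have hd1 : HasFDerivAt A (fderiv ℝ A u₀) u₀ := (hA.differentiableAt (by simp)).hasFDerivAt
  have hinv : HasFDerivAt (fun u => Ring.inverse (A u)) (-(fderiv ℝ A u₀)) u₀ := by
    have h1 := hasFDerivAt_ringInverse (𝕜 := ℝ) (1 : Rˣ)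
    rw [Units.val_one, ← hA1] at h1
    refine (h1.comp u₀ hd1).congr_fderiv ?_
    ext1 v
    simp
  have hsecond : ∀ w w', m (fderiv ℝ (fderiv ℝ A) u₀ w' w)
      = m (fderiv ℝ A u₀ w * fderiv ℝ A u₀ w') := by
    intro w w'
    have h2 := (hd2.clm_apply (hasFDerivAt_const w u₀)).mul' hinv
    have h3 := m.hasFDerivAt.comp u₀ h2
    have h4 : HasFDerivAt (fun _ : F => (0 : ℝ)) _ u₀ :=
      h3.congr_of_eventuallyEq (by
        filter_upwards [hm w] with u hu
        exact hu.symm)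
    have h5 := DFunLike.congr_fun (h4.unique (hasFDerivAt_const (0 : ℝ) u₀)) w'
    simp [hA1] at h5
    linarith
  have hsymm : fderiv ℝ (fderiv ℝ A) u₀ w' w = fderiv ℝ (fderiv ℝ A) u₀ w w' :=
    (hA.isSymmSndFDerivAt (by simpa using h2)).eq w' w
  rw [map_sub, ← hsecond w w', ← hsecond w' w, hsymm, sub_self]

/-- Let `f` be a smooth map into the three-forms through the form `φ` of a cross product. It is
impossible that everywhere its differential maps onto the space of derivatives of the form in
symmetric directions. Indeed `f = A^* φ` with a smooth function `A`, and modulo the stabiliser of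
`φ` the form `dA · A⁻¹` takes exactly the symmetric endomorphisms as values; the symmetry of the
second derivative of `A` forces their commutators to act on `φ` like symmetric endomorphisms. -/
theorem IsCrossForm.not_integral (hB : IsCrossForm B φ) {F : Type*} [NormedAddCommGroup F]
    [NormedSpace ℝ F] {U : Set F} (hU : IsOpen U) {f : F → ThreeForm E7} {u₀ : F} (hu₀ : u₀ ∈ U)
    (h0 : f u₀ = φ) (hf : ∀ X, ContDiffOn ℝ ∞ (fun u => f u X) U)
    (hD : ∀ u ∈ U, ∃ L : F → ThreeForm E7, (∀ X w, fderiv ℝ (fun u => f u X) u w = L w X) ∧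
      ∀ A : E7 ≃ₗ[ℝ] E7, f u = φ.compLinearMap A.toLinearMap → Set.range L =
        {η | ∃ S : E7 →ₗ[ℝ] E7, S.IsSymmetric ∧
          η = (formDeriv φ S).compLinearMap A.toLinearMap}) : False := by
  obtain ⟨A, hA, hA1, hfA⟩ := hB.exists_smooth_lift h0
    fun X => (hf X).contDiffAt (hU.mem_nhds hu₀)
  have hAunit : ∀ᶠ u in 𝓝 u₀, IsUnit (A u) :=
    hA.continuousAt.eventually (p := IsUnit) (by rw [hA1]; exact Units.isOpen.mem_nhds isUnit_one)
  have hAdiff : ∀ᶠ u in 𝓝 u₀, DifferentiableAt ℝ A u := by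
    have h1 : ∀ᶠ u in 𝓝 u₀, ContDiffAt ℝ 1 A u :=
      (hA.of_le (by exact_mod_cast le_top)).eventually (by simp)
    filter_upwards [h1] with u hu
    exact hu.differentiableAt (by simp)
  -- the value of `L w` in terms of the derivative of `A`
  have key : ∀ᶠ u in 𝓝 u₀, IsUnit (A u) ∧ ∃ L : F → ThreeForm E7,
      (∀ w x y z, L w ![x, y, z] = φ ![fderiv ℝ A u w x, A u y, A u z]
        + φ ![A u x, fderiv ℝ A u w y, A u z] + φ ![A u x, A u y, fderiv ℝ A u w z]) ∧
      Set.range L = {η | ∃ S : E7 →ₗ[ℝ] E7, S.IsSymmetric ∧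
          η = (formDeriv φ S).compLinearMap (A u).toLinearMap} := by
    filter_upwards [hU.mem_nhds hu₀, hAunit, hAdiff, hfA.eventually_nhds] with u hu h1 h2 h3
    refine ⟨h1, ?_⟩
    obtain ⟨L, hL, hL'⟩ := hD u hu
    refine ⟨L, fun w x y z => ?_, ?_⟩
    · obtain ⟨D, hD1, hD2⟩ := hB.hasFDerivAt_eval h2.hasFDerivAt x y z
      rw [← hL, ← hD2, ← hD1.fderiv]
      congr 1
      refine Filter.EventuallyEq.fderiv_eq ?_
      filter_upwards [h3] with u' hu'
      rw [hu', compLinearMap_vec3]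
      rfl
    · obtain ⟨a, ha⟩ := h1
      have e := hL' (ContinuousLinearEquiv.unitsEquiv ℝ E7 a).toLinearEquiv (by
        rw [h3.self_of_nhds, ← ha]; rfl)
      rw [e, ← ha]
      rfl
  have key1 : ∀ᶠ u in 𝓝 u₀, ∀ w, ∃ S : E7 →ₗ[ℝ] E7, S.IsSymmetric ∧
      formDeriv φ (fderiv ℝ A u w * Ring.inverse (A u)).toLinearMap = formDeriv φ S := by
    filter_upwards [key] with u hu w
    obtain ⟨⟨a, ha⟩, L, hL, hL'⟩ := hu
    obtain ⟨S, hS, hS'⟩ : L w ∈ {η | ∃ S : E7 →ₗ[ℝ] E7, S.IsSymmetric ∧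
      η = (formDeriv φ S).compLinearMap (A u).toLinearMap} := hL' ▸ Set.mem_range_self w
    refine ⟨S, hS, ThreeForm.ext3 fun x y z => ?_⟩
    have hinv : ∀ x, A u (Ring.inverse (A u) x) = x := fun x => by
      rw [← ha, Ring.inverse_unit, ← mul_apply_eq_comp, Units.mul_inv,
        one_apply_eq_self]
    have e := hL w (Ring.inverse (A u) x) (Ring.inverse (A u) y) (Ring.inverse (A u) z)
    rw [hS', compLinearMap_vec3] at e
    simp only [ContinuousLinearMap.coe_coe, hinv] at e
    rw [e, formDeriv_apply]
    rfl
  obtain ⟨S, S', hS, hS', hSS⟩ := hB.exists_symmetric_commutator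
  -- symmetric directions are attained at `u₀`
  have hatt : ∀ S : E7 →ₗ[ℝ] E7, S.IsSymmetric →
      ∃ w, formDeriv φ (fderiv ℝ A u₀ w).toLinearMap = formDeriv φ S := by
    intro S hS
    obtain ⟨-, L, hL, hL'⟩ := key.self_of_nhds
    obtain ⟨w, hw⟩ : formDeriv φ S ∈ Set.range L := by
      rw [hL', hA1]
      exact ⟨S, hS, rfl⟩
    refine ⟨w, ThreeForm.ext3 fun x y z => ?_⟩
    rw [← hw, hL, formDeriv_apply, hA1]
    rfl
  obtain ⟨w, hw⟩ := hatt S hS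
  obtain ⟨w', hw'⟩ := hatt S' hS'
  let symm : Submodule ℝ (E7 →ₗ[ℝ] E7) :=
    { carrier := {S | S.IsSymmetric}
      add_mem' := fun h h' => h.add h'
      zero_mem' := LinearMap.IsSymmetric.zero
      smul_mem' := fun r S h => h.smul (by simp) }
  let K : Submodule ℝ (ThreeForm E7) := symm.map (formDeriv φ)
  have hmem : formDeriv φ ((fderiv ℝ A u₀ w).toLinearMap ∘ₗ (fderiv ℝ A u₀ w').toLinearMap
      - (fderiv ℝ A u₀ w').toLinearMap ∘ₗ (fderiv ℝ A u₀ w).toLinearMap) ∈ K := by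
    by_contra hnot
    obtain ⟨l, hl, hlK⟩ := Submodule.exists_le_ker_of_notMem hnot
    apply hl
    let m : (E7 →L[ℝ] E7) →L[ℝ] ℝ := LinearMap.toContinuousLinearMap
      (l ∘ₗ formDeriv φ ∘ₗ (ContinuousLinearMap.coeLM ℝ))
    have hm : ∀ a : E7 →L[ℝ] E7, m a = l (formDeriv φ a.toLinearMap) := fun a => rfl
    have hzero : ∀ w, ∀ᶠ u in 𝓝 u₀, m (fderiv ℝ A u w * Ring.inverse (A u)) = 0 := by
      intro w
      filter_upwards [key1] with u hu
      obtain ⟨S, hS, e⟩ := hu w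
      rw [hm, e]
      exact hlK ⟨S, hS, rfl⟩
    have e1 := map_commutator_eq_zero hA hA1 m hzero w w'
    have e3 := hm (fderiv ℝ A u₀ w * fderiv ℝ A u₀ w' - fderiv ℝ A u₀ w' * fderiv ℝ A u₀ w)
    rw [e1] at e3
    exact e3.symm
  obtain ⟨S'', hS'', e⟩ := hmem
  exact hSS _ _ hw hw' S'' hS'' e.symm

end Integral

/-! ### Velocities of horizontal curves -/

section Velocity

/-- In finite dimensions operators may be differentiated pointwise. -/
theorem hasDerivAt_clm_of_apply {A : ℝ → E7 →L[ℝ] E7} {A' : E7 →L[ℝ] E7} {t : ℝ}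
    (h : ∀ y, HasDerivAt (fun τ => A τ y) (A' y) t) : HasDerivAt A A' t := by
  let b := (EuclideanSpace.basisFun (Fin 7) ℝ).toBasis
  have e : ∀ C : E7 →L[ℝ] E7, C = ∑ i, (LinearMap.toContinuousLinearMap (b.coord i)).smulRight
      (C (b i)) := by
    intro C
    ext1 y
    conv_lhs => rw [← b.sum_repr y]
    rw [map_sum, sum_apply]
    exact Finset.sum_congr rfl fun i _ => map_smul _ _ _
  have h1 : HasDerivAt (fun τ => ∑ i, (LinearMap.toContinuousLinearMap (b.coord i)).smulRight
      (A τ (b i))) (∑ i, (LinearMap.toContinuousLinearMap (b.coord i)).smulRight (A' (b i))) t := by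
    refine HasDerivAt.fun_sum fun i _ => ?_
    exact ((ContinuousLinearMap.smulRightL ℝ E7 E7
      (LinearMap.toContinuousLinearMap (b.coord i))).hasFDerivAt.comp_hasDerivAt t (h (b i)))
  rw [← e] at h1
  exact h1.congr_of_eventuallyEq (Filter.Eventually.of_forall fun τ => e (A τ))

variable {V : Type*} [AddCommGroup V] [Module ℝ V]

/-- If a curve of frames has velocity `p ∘ S` at `t`, then the velocity of the inverse frames is
`- S ∘ p⁻¹`. -/
theorem hasDerivAt_frame_symm {p : ℝ → E7 ≃ₗ[ℝ] V} {S : E7 →ₗ[ℝ] E7} {t : ℝ}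
    (h : ∀ y, HasDerivAt (fun τ => (p t).symm (p τ y)) (S y) t) (Y : V) :
    HasDerivAt (fun τ => (p τ).symm Y) (-S ((p t).symm Y)) t := by
  let A : ℝ → E7 →L[ℝ] E7 := fun τ => LinearMap.toContinuousLinearMap
    ((p τ).trans (p t).symm).toLinearMap
  let A' : ℝ → E7 →L[ℝ] E7 := fun τ => LinearMap.toContinuousLinearMap
    ((p t).trans (p τ).symm).toLinearMap
  let u : ℝ → (E7 →L[ℝ] E7)ˣ := fun τ => ⟨A τ, A' τ, by ext1 y; simp [A, A'],
    by ext1 y; simp [A, A']⟩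
  have hA : HasDerivAt A (LinearMap.toContinuousLinearMap S) t := hasDerivAt_clm_of_apply h
  have ht : u t = 1 := by
    ext1
    ext1 y
    simp [u, A]
  have h1 := (hasFDerivAt_ringInverse (𝕜 := ℝ) (u t)).comp_hasDerivAt t hA
  have h2 := h1.clm_apply (hasDerivAt_const t ((p t).symm Y))
  rw [ht] at h2
  have h3 : (fun τ => (p τ).symm Y) = fun τ => (Ring.inverse ∘ A) τ ((p t).symm Y) := by
    funext τ
    have e : Ring.inverse (A τ) = A' τ := Ring.inverse_unit (u τ)
    rw [Function.comp_apply, e]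
    simp [A']
  rw [h3]
  refine h2.congr_deriv ?_
  simp

theorem hasDerivAt_frameMetric {p : ℝ → E7 ≃ₗ[ℝ] V} {S : E7 →ₗ[ℝ] E7} {t : ℝ} (hS : S.IsSymmetric)
    (h : ∀ y, HasDerivAt (fun τ => (p t).symm (p τ y)) (S y) t) (X Y : V) :
    HasDerivAt (fun τ => frameMetric (p τ) X Y) (frameBilin (p t) ((-2 : ℝ) • S) X Y) t := by
  refine ((hasDerivAt_frame_symm h X).inner ℝ (hasDerivAt_frame_symm h Y)).congr_deriv ?_
  rw [frameBilin_apply, LinearMap.smul_apply, real_inner_smul_left, inner_neg_left, inner_neg_right,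
    hS]
  ring

variable {Δ : Type*} [NormedAddCommGroup Δ] [InnerProductSpace ℝ Δ] [Module Cl7 Δ]
  [hΔ : IsSpinModule Δ]

theorem hasDerivAt_frameForm {p : ℝ → E7 ≃ₗ[ℝ] V} {S : E7 →ₗ[ℝ] E7} {t : ℝ} {v : ℝ → Δ}
    (h : ∀ y, HasDerivAt (fun τ => (p t).symm (p τ y)) (S y) t) (hv : HasDerivAt v 0 t)
    (X : Fin 3 → V) :
    HasDerivAt (fun τ => frameForm (p τ) (v τ) X)
      ((formDeriv (frameForm (LinearEquiv.refl ℝ E7) (v t)) (-S)).compLinearMap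
        (p t).symm.toLinearMap X) t := by
  obtain ⟨w, hw⟩ := exists_range_spinorMap_eq_top (Δ := Δ)
  have : FiniteDimensional ℝ Δ := Module.Finite.of_surjective _ (LinearMap.range_eq_top.mp hw)
  let cl : E7 →L[ℝ] Δ →L[ℝ] Δ := LinearMap.toContinuousLinearMap
    (LinearMap.toContinuousLinearMap.toLinearMap ∘ₗ LinearMap.mk₂ ℝ (fun x w => vec x • w)
      (fun x y w => by rw [map_add, add_smul]) (fun r x w => vec_real_smul_smul x r w)
      (fun x v w => smul_add _ _ _) (fun r x w => vec_smul_real_smul x r w))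
  have hcl : ∀ x (w : Δ), vec x • w = cl x w := fun _ _ => rfl
  rw [eq_vec3 X, compLinearMap_vec3, formDeriv_apply]
  simp only [frameForm_apply, hcl]
  have hp : ∀ Y, HasDerivAt (fun τ => cl ((p τ).symm Y)) (cl (-S ((p t).symm Y))) t := fun Y =>
    cl.hasFDerivAt.comp_hasDerivAt t (hasDerivAt_frame_symm h Y)
  refine (((hp _).clm_apply ((hp _).clm_apply ((hp _).clm_apply hv))).inner ℝ hv).congr_deriv ?_
  simp only [inner_zero_right, zero_add, map_zero, add_zero, inner_add_left, map_add,
    LinearMap.neg_apply, LinearEquiv.coe_coe]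
  simp
  ring

end Velocity

/-! ### The horizontal distribution and its image -/

section Horizontal

variable {M : Type*} [TopologicalSpace M] [ChartedSpace E7 M] [IsManifold (𝓡 7) ∞ M]
  {o : OrientedFrames M} {P : SpinStructure o} {Δ : Type*} [NormedAddCommGroup Δ]
  [InnerProductSpace ℝ Δ] [Module Cl7 Δ] [hΔ : IsSpinModule Δ] {x : M}

/-- The velocities of the metric and of the three-form along a horizontal curve. -/
theorem HorizontalAt.exists_deriv {s : ℝ → Spinor P Δ x} {t : ℝ} (h : HorizontalAt s t) :
    ∃ (σ : P.fib x) (v : Δ) (S : E7 →ₗ[ℝ] E7), s t = Spinor.mk σ v ∧ S.IsSymmetric ∧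
      (∀ X Y, HasDerivAt (fun τ => (s τ).metric X Y)
        (frameBilin (P.toFrame σ) ((-2 : ℝ) • S) X Y) t) ∧
      ∀ X, HasDerivAt (fun τ => (s τ).form X)
        ((formDeriv (frameForm (LinearEquiv.refl ℝ E7) v) (-S)).compLinearMap
          (P.toFrame σ).symm.toLinearMap X) t := by
  obtain ⟨σ, v, S, hs, -, hS, hσ, hv⟩ := h
  refine ⟨σ t, v t, S, hs.self_of_nhds, hS, fun X Y => ?_, fun X => ?_⟩
  · refine (hasDerivAt_frameMetric (p := fun τ => P.toFrame (σ τ)) hS hσ X Y).congr_of_eventuallyEq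
      ?_
    filter_upwards [hs] with τ hτ
    rw [hτ, Spinor.metric_mk]
  · refine (hasDerivAt_frameForm (p := fun τ => P.toFrame (σ τ)) hσ hv X).congr_of_eventuallyEq ?_
    filter_upwards [hs] with τ hτ
    rw [hτ, Spinor.form_mk]

/-- The linear automorphism `exp (t S)`. -/
noncomputable def expEquiv (S : E7 →L[ℝ] E7) (t : ℝ) : E7 ≃ₗ[ℝ] E7 :=
  letI : NormedAlgebra ℚ (E7 →L[ℝ] E7) := .restrictScalars ℚ ℝ _
  (ContinuousLinearEquiv.unitsEquiv ℝ E7 (NormedSpace.isUnit_exp (t • S)).unit).toLinearEquiv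

theorem expEquiv_apply (S : E7 →L[ℝ] E7) (t : ℝ) (y : E7) :
    expEquiv S t y = NormedSpace.exp (t • S) y := rfl

theorem expEquiv_zero (S : E7 →L[ℝ] E7) : expEquiv S 0 = LinearEquiv.refl ℝ E7 := by
  ext1 y
  have h : (0 : ℝ) • S = 0 := zero_smul ℝ S
  rw [expEquiv_apply, h, NormedSpace.exp_zero]
  rfl

theorem det_expEquiv_pos (S : E7 →L[ℝ] E7) (t : ℝ) :
    0 < LinearMap.det (expEquiv S t).toLinearMap := by
  have h : (expEquiv S t).toLinearMap
      = (expEquiv S (t / 2)).toLinearMap ∘ₗ (expEquiv S (t / 2)).toLinearMap := by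
    ext1 y
    change NormedSpace.exp (t • S) y
      = (NormedSpace.exp ((t / 2) • S) * NormedSpace.exp ((t / 2) • S)) y
    let _ : NormedAlgebra ℚ (E7 →L[ℝ] E7) := .restrictScalars ℚ ℝ _
    have h2 : (t / 2) • S + (t / 2) • S = t • S :=
      (add_smul (t / 2) (t / 2) S).symm.trans (by rw [add_halves])
    rw [← NormedSpace.exp_add_of_commute (Commute.refl _), h2]
  rw [h, LinearMap.det_comp]
  exact mul_self_pos.mpr (LinearEquiv.isUnit_det' _).ne_zero

theorem hasDerivAt_expEquiv (S : E7 →L[ℝ] E7) (t : ℝ) (y : E7) :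
    HasDerivAt (fun τ => expEquiv S τ y) (expEquiv S t (S y)) t :=
  (hasDerivAt_exp_smul_const S t).clm_apply (hasDerivAt_const t y) |>.congr_deriv (by
    simp only [map_zero, add_zero]
    rfl)

theorem trans_mem_carrier {p : E7 ≃ₗ[ℝ] TangentSpace (𝓡 7) x}
    (hp : (⟨x, p⟩ : FrameBundle M) ∈ o.carrier) (S : E7 →L[ℝ] E7) (t : ℝ) :
    (⟨x, (expEquiv S t).trans p⟩ : FrameBundle M) ∈ o.carrier := by
  rw [o.mem_iff x p _ hp]
  have h : (((expEquiv S t).trans p).trans p.symm) = expEquiv S t := by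
    ext1 y
    simp
  rw [h]
  exact det_expEquiv_pos S t

theorem continuous_frame_curve (p : E7 ≃ₗ[ℝ] TangentSpace (𝓡 7) x) (S : E7 →L[ℝ] E7) :
    Continuous (fun t => (⟨x, (expEquiv S t).trans p⟩ : FrameBundle M)) := by
  refine continuous_induced_rng.mpr (continuous_pi fun i => ?_)
  have h1 : Continuous (fun t => p (expEquiv S t (EuclideanSpace.single i 1))) := by
    have h2 : Continuous (fun t => expEquiv S t (EuclideanSpace.single i (1 : ℝ))) :=
      continuous_iff_continuousAt.mpr fun t => (hasDerivAt_expEquiv S t _).continuousAt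
    exact (LinearMap.continuous_of_finiteDimensional
      (p.toLinearMap : E7 →ₗ[ℝ] E7)).comp h2
  exact (FiberBundle.continuous_totalSpaceMk E7 (TangentSpace (𝓡 7) : M → Type _) x).comp h1

/-- The curve of frames `p ∘ exp (t S)` lifts to the spin structure near `t = 0`, because the
covering map is a local homeomorphism. -/
theorem exists_frame_lift (σ₀ : P.fib x) (S : E7 →L[ℝ] E7) : ∃ σ : ℝ → P.fib x, σ 0 = σ₀ ∧
    (∀ t, P.toFrame (σ t) = (expEquiv S t).trans (P.toFrame σ₀)) ∧
    ContinuousAt (fun t => (⟨x, σ t⟩ : Bundle.TotalSpace Spin7 P.fib)) 0 := by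
  let π : Bundle.TotalSpace Spin7 P.fib → o.carrier := fun σ =>
    ⟨⟨σ.proj, P.toFrame σ.snd⟩, P.toFrame_mem σ.snd⟩
  let c : ℝ → o.carrier := fun t =>
    ⟨⟨x, (expEquiv S t).trans (P.toFrame σ₀)⟩, trans_mem_carrier (P.toFrame_mem σ₀) S t⟩
  have hc : Continuous c := (continuous_frame_curve (P.toFrame σ₀) S).subtype_mk _
  obtain ⟨e, he, hπ⟩ := P.isCoveringMap.isLocalHomeomorph ⟨x, σ₀⟩
  have hc0 : c 0 = e ⟨x, σ₀⟩ := by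
    rw [← hπ]
    refine Subtype.ext ?_
    change (⟨x, (expEquiv S 0).trans (P.toFrame σ₀)⟩ : FrameBundle M) = ⟨x, P.toFrame σ₀⟩
    rw [expEquiv_zero]
    rfl
  have hex : ∀ t, ∃ σ : P.fib x, P.toFrame σ = (expEquiv S t).trans (P.toFrame σ₀) ∧
      (c t ∈ e.target → (⟨x, σ⟩ : Bundle.TotalSpace Spin7 P.fib) = e.symm (c t)) := by
    intro t
    by_cases ht : c t ∈ e.target
    · have h1 : π (e.symm (c t)) = c t := by
        have h2 := e.right_inv ht
        rw [← hπ] at h2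
        exact h2
      generalize e.symm (c t) = τ' at h1 ⊢
      obtain ⟨y, τ⟩ := τ'
      have h2 : (⟨y, P.toFrame τ⟩ : FrameBundle M)
          = ⟨x, (expEquiv S t).trans (P.toFrame σ₀)⟩ := congrArg Subtype.val h1
      obtain rfl : y = x := congrArg FrameBundle.base h2
      rw [FrameBundle.mk.injEq] at h2
      exact ⟨τ, h2.2, fun _ => rfl⟩
    · obtain ⟨σ, hσ⟩ := exists_toFrame_eq P (trans_mem_carrier (P.toFrame_mem σ₀) S t)
      exact ⟨σ, hσ, fun h => absurd h ht⟩
  choose σ hσ hσe using hex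
  have ht0 : c 0 ∈ e.target := by
    rw [hc0]
    exact e.map_source he
  refine ⟨σ, ?_, hσ, ?_⟩
  · have h1 := hσe 0 ht0
    rw [hc0, e.left_inv he] at h1
    exact eq_of_heq (Bundle.TotalSpace.mk.injEq .. ▸ h1).2
  · have h1 : ContinuousAt (fun t => e.symm (c t)) 0 :=
      (e.continuousAt_symm ht0).comp hc.continuousAt
    refine h1.congr ?_
    filter_upwards [hc.continuousAt (e.open_target.mem_nhds ht0)] with t ht
    exact (hσe t ht).symm

theorem isSymmetric_neg {S : E7 →ₗ[ℝ] E7} (hS : S.IsSymmetric) : (-S).IsSymmetric := fun x y => by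
  rw [LinearMap.neg_apply, LinearMap.neg_apply, inner_neg_left, inner_neg_right, hS]

/-- A horizontal curve through `s` may be chosen with constant spinor component, and with frames
`p ∘ exp (t S)` for an arbitrary symmetric `S`. -/
theorem horizontalImage_eq_Lambda28 {s : Spinor P Δ x} (hs : s ∈ unitSpinors P Δ x) :
    horizontalImage s = Lambda28 P Δ s.form := by
  ext η
  constructor
  · rintro ⟨c, hc, hc0, hh, hη⟩
    obtain ⟨σ, v, S, hcv, hS, -, hform⟩ := hh.exists_deriv
    rw [hc0] at hcv
    subst hcv
    have hpos : (Spinor.mk σ v).form ∈ positiveForms P Δ x := by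
      rw [← image_form_unitSpinors]
      exact ⟨_, hs, rfl⟩
    rw [Spinor.form_mk] at hpos ⊢
    rw [mem_Lambda28_iff hs hpos]
    exact ⟨-S, (isSymmetric_neg hS), AlternatingMap.ext fun X => (hη X).unique (hform X)⟩
  · obtain ⟨σ₀, v, rfl⟩ := s.exists_mk
    have hpos : (Spinor.mk σ₀ v).form ∈ positiveForms P Δ x := by
      rw [← image_form_unitSpinors]
      exact ⟨_, hs, rfl⟩
    rw [Spinor.form_mk] at hpos ⊢
    rw [mem_Lambda28_iff hs hpos]
    rintro ⟨S, hS, rfl⟩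
    let S' : E7 →L[ℝ] E7 := LinearMap.toContinuousLinearMap (-S)
    obtain ⟨σ, hσ0, hσ, hcont⟩ := exists_frame_lift σ₀ S'
    have hderiv : ∀ y, HasDerivAt (fun τ => (P.toFrame (σ 0)).symm (P.toFrame (σ τ) y))
        ((-S) y) 0 := by
      intro y
      simp only [hσ0, hσ]
      have h1 := hasDerivAt_expEquiv S' 0 y
      rw [expEquiv_zero] at h1
      simpa [S'] using h1
    refine ⟨fun τ => Spinor.mk (σ τ) v, fun τ => hs, congrArg (Spinor.mk · v) hσ0,
      ⟨σ, fun _ => v, -S, Filter.Eventually.of_forall fun τ => rfl, hcont, (isSymmetric_neg hS), hderiv,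
        hasDerivAt_const _ _⟩, fun X => ?_⟩
    have h2 := hasDerivAt_frameForm (p := fun τ => P.toFrame (σ τ)) hderiv
      (hasDerivAt_const (0 : ℝ) v) X
    rw [neg_neg, hσ0] at h2
    exact h2

variable (P Δ x) in
theorem unitSpinors_nonempty : (unitSpinors P Δ x).Nonempty := by
  obtain ⟨p, hp⟩ := o.exists_frame x
  obtain ⟨σ, -⟩ := exists_toFrame_eq P hp
  have := hΔ.isSimple
  have : Nontrivial Δ := IsSimpleModule.nontrivial Cl7 Δ
  obtain ⟨v, hv⟩ := exists_norm_eq Δ zero_le_one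
  exact ⟨Spinor.mk σ v, hv⟩

variable (P Δ x) in
theorem not_isIntegrable : ¬ IsIntegrable (positiveForms P Δ x) (Lambda28 P Δ) := by
  intro hint
  obtain ⟨s, hs⟩ := unitSpinors_nonempty P Δ x
  obtain ⟨σ, v, rfl⟩ := s.exists_mk
  obtain ⟨B, hB⟩ := exists_isCrossForm (Δ := Δ) (v := v) hs
  have hpos : (Spinor.mk σ v).form ∈ positiveForms P Δ x := by
    rw [← image_form_unitSpinors]
    exact ⟨_, hs, rfl⟩
  obtain ⟨k, U, f, hU, ⟨u₀, hu₀, hfu₀⟩, hfU, hf, hL⟩ := hint _ hpos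
  let p := P.toFrame σ
  refine hB.not_integral hU (f := fun u => (f u).compLinearMap p.toLinearMap) hu₀ ?_
    (fun X => hf _) fun u hu => ?_
  · refine ThreeForm.ext3 fun X Y Z => ?_
    rw [hfu₀, Spinor.form_mk, compLinearMap_vec3, frameForm_vec3 (P.toFrame σ)]
    simp [p]
  · obtain ⟨L, hL1, -, hL2⟩ := hL u hu
    refine ⟨fun w => (L w).compLinearMap p.toLinearMap, fun X w => hL1 _ w, fun A hA => ?_⟩
    -- in the frame `p ∘ A⁻¹` the three-form `f u` is the model form
    have hfu : f u = frameForm (A.symm.trans p) v := by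
      refine ThreeForm.ext3 fun X Y Z => ?_
      have e := DFunLike.congr_fun hA ![p.symm X, p.symm Y, p.symm Z]
      simp only [compLinearMap_vec3, LinearEquiv.coe_coe, p.apply_symm_apply] at e
      rw [e, frameForm_vec3 (A.symm.trans p)]
      rfl
    have hD : ∀ η, η ∈ Set.range L ↔ ∃ S : E7 →ₗ[ℝ] E7, S.IsSymmetric ∧
        η = (formDeriv (frameForm (LinearEquiv.refl ℝ E7) v) S).compLinearMap
          (A.symm.trans p).symm.toLinearMap := by
      intro η
      rw [hL2, hfu]
      exact mem_Lambda28_iff hs (hfu ▸ hfU u hu) η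
    ext η
    constructor
    · rintro ⟨w, rfl⟩
      obtain ⟨S, hS, e⟩ := (hD (L w)).mp ⟨w, rfl⟩
      refine ⟨S, hS, ThreeForm.ext3 fun X Y Z => ?_⟩
      simp only [e, compLinearMap_vec3]
      simp
    · rintro ⟨S, hS, rfl⟩
      obtain ⟨w, hw⟩ := (hD _).mpr ⟨S, hS, rfl⟩
      refine ⟨w, ThreeForm.ext3 fun X Y Z => ?_⟩
      simp only [hw, compLinearMap_vec3]
      simp

end Horizontal
end UniversalSpinor

theorem mainTheorem10 {M : Type*} [TopologicalSpace M] [ChartedSpace E7 M]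
    [IsManifold (𝓡 7) ∞ M] {o : OrientedFrames M} (P : SpinStructure o)
    (Δ : Type*) [NormedAddCommGroup Δ] [InnerProductSpace ℝ Δ] [Module Cl7 Δ]
    [IsSpinModule Δ] (x : M) :
    Spinor.form '' unitSpinors P Δ x = positiveForms P Δ x ∧
    (∀ s ∈ unitSpinors P Δ x, horizontalImage s = Lambda28 P Δ s.form) ∧
    (∀ s ∈ unitSpinors P Δ x, Set.InjOn (iMap s.metric s.form) {h | h.IsSymm}) ∧
    ¬ IsIntegrable (positiveForms P Δ x) (Lambda28 P Δ) ∧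
    (∀ (J : Set ℝ) (s : ℝ → Spinor P Δ x), IsOpen J →
      (∀ t ∈ J, s t ∈ unitSpinors P Δ x) → (∀ t ∈ J, HorizontalAt s t) →
      ∀ t ∈ J, ∃ h : LinearMap.BilinForm ℝ (TangentSpace (𝓡 7) x), h.IsSymm ∧
        (∀ X Y, HasDerivAt (fun τ => (s τ).metric X Y) (h X Y) t) ∧
        ∀ X, HasDerivAt (fun τ => (s τ).form X) ((3 / 2 : ℝ) * iMap (s t).metric (s t).form h X) t) :=
  by
  refine ⟨image_form_unitSpinors, fun s hs => horizontalImage_eq_Lambda28 hs, fun s hs => ?_,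
    not_isIntegrable P Δ x, fun J s _ _ hh t ht => ?_⟩
  · obtain ⟨σ, v, rfl⟩ := s.exists_mk
    exact injOn_iMap_frame (P.toFrame σ) hs
  · obtain ⟨σ, v, S, hst, hS, hmetric, hform⟩ := (hh t ht).exists_deriv
    refine ⟨frameBilin (P.toFrame σ) ((-2 : ℝ) • S), frameBilin_isSymm _ (hS.smul (by simp)),
      hmetric, fun X => (hform X).congr_deriv ?_⟩
    rw [hst, Spinor.metric_mk, Spinor.form_mk, iMap_frame _ v (frameBilin_frame _ _), map_smul,
      map_neg, AlternatingMap.smul_apply, AlternatingMap.compLinearMap_apply,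
      AlternatingMap.compLinearMap_apply, AlternatingMap.smul_apply, AlternatingMap.neg_apply,
      smul_eq_mul, smul_eq_mul]
    ring
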